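/- **Setting.** Let $n\ge 1$, $L\ge 2$, $M\ge1$ be integers, $P>0$, $\sigma>0$, $v=P/\sigma^2$, $N=LM$. Let $\mathcal B\subset\{0,1\}^N$ be the set of vectors $\beta$ which, when split into $L$ sections of size $M$, have exactly one entry equal to $1$ in each section. Let $X$ be a random $n\times N$ matrix whose entries are independent and equal to $\pm\sqrt{P/L}$ with probability $1/2$ each. When $\beta^*\in\mathcal B$ is sent, $Y=X\beta^*+\epsilon$ is received, where $\epsilon\in\mathbb R^n$ is independent of $X$ and has independent $N(0,\sigma^2)$ coordinates. Let $\hat\beta=\hat\beta(X,Y)$ be a minimiser of $\|Y-X\beta\|^2$ over $\beta\in\mathcal B$ (ties broken in an arbitrary way), and let $E_l$ be the event that $\hat\beta$ and $\beta^*$ differ in exactly $l$ sections. Put $R=(L\ln M)/n$ (the rate in nats per transmission), $C_\alpha=\frac12\ln(1+\alpha v)$ and $$D(\Delta,1-\rho^2)=\max_{\lambda\ge0}\Bigl\{\lambda\Delta+\tfrac12\ln(1-\lambda^2(1-\rho^2))\Bigr\},\qquad D_1(\Delta,1-\rho^2)=\max_{0\le\lambda\le1}\Bigl\{\lambda\Delta+\tfrac12\ln(1-\lambda^2(1-\rho^2))\Bigr\},$$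 where only those $\lambda$ with $1-\lambda^2(1-\rho^2)>0$ count. Let $\eta=\sqrt{9/(8\pi e)}$, $c_\zeta=\frac1{(1+2\zeta)^2}+\frac1{(1-2\zeta)^2}$, $\phi(x)=\inf_{\zeta\in(0,1/2)}\phi_\zeta(x)$ and $$\phi_\zeta(x)=\max\Bigl\{\Bigl(\tfrac3{16}c_\zeta^2+\tfrac1{12}\Bigr)\tfrac1x,\ -\tfrac{4\zeta^4}3x+\ln\tfrac x2+\tfrac1{12x},\ -\Bigl(\ln2-\tfrac12\Bigr)x+\tfrac12\ln\tfrac{\pi x}2\Bigr\}.$$ **Lemma.** Let $\alpha_0\in(0,1]$. For every $L\ge2$, every integer $l$ such that $\alpha=l/L$ satisfies $\alpha_0\le\alpha\le1$ and $C_\alpha-\alpha R\ge0$, and every $\beta^*\in\mathcal B$, the function $$err_{Ber}(\alpha)=\binom L{\alpha L}\exp\{-n(D_1(\Delta_\alpha,1-\rho_1^2)-\iota_1)\}+\exp\{-n(D(t_\alpha,1-\rho_2^2)-\iota_2)\}$$ of $t_\alpha$ has a minimum over $t_\alpha\in[0,C_\alpha-\alpha R]$, and $\Pr[E_l]$ is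 at most this minimum. Here $\Delta_\alpha=C_\alpha-\alpha R-t_\alpha$, $1-\rho_1^2=\alpha(1-\alpha)v/(1+\alpha v)$, $1-\rho_2^2=\alpha^2v/(1+\alpha^2v)$, $$\iota_1=\ln\bigl((1+\iota_3)(1+\max\{\iota_4,\iota_5\})\bigr),\qquad \iota_2=\phi(L)+\ln\Bigl(1+\frac{2\eta}L\Bigr),$$ $$1+\iota_3=\max_{\alpha_0L\le k\le L}e^{\phi(k)}\Bigl(1+\frac{\eta(1+v)}k\Bigr),\qquad 1+\iota_4=\max_{\alpha_0L\le k\le L-\sqrt L}e^{\phi(k)+\phi(L-k)}\Bigl(1+\frac\eta k\Bigr)\Bigl(1+\frac\eta{L-k}\Bigr),$$ $$1+\iota_5=\max_{L-\sqrt L\le k\le L-1}\frac{e^{\phi(k)}}{\sqrt{1-1/\sqrt L}}\Bigl(1+\frac\eta k\Bigr),$$ the maxima being over integers $k$; if there is no $k$ in the range for $\iota_4$, then $\max\{\iota_4,\iota_5\}$ means $\iota_5$. -/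

import Mathlib

open MeasureTheory ProbabilityTheory

namespace SparseSuperposition

noncomputable section

/-! ### The code, the channel and the decoder

There are `L` sections of size `M`; the `N = L * M` columns of the dictionary are indexed by
pairs (section, position). -/

/-- The set of admissible coefficient vectors: entries in `{0, 1}`, with exactly one entry
equal to `1` in each section. -/
def codebook (L M : ℕ) : Set (Fin L × Fin M → ℝ) :=
  {β | (∀ j, β j = 0 ∨ β j = 1) ∧ ∀ s : Fin L, ∃! p : Fin M, β (s, p) = 1}

/-- The codeword `X β = ∑ j, β_j X_j`, where `X_j` is the `j`-th column of the `n × N`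
dictionary `X`. -/
def codeword {n L M : ℕ} (X : Fin n → Fin L × Fin M → ℝ) (β : Fin L × Fin M → ℝ) :
    Fin n → ℝ :=
  fun i => ∑ j, β j * X i j

/-- The squared Euclidean norm `‖y‖²`. -/
def sqNorm {n : ℕ} (y : Fin n → ℝ) : ℝ := ∑ i, y i ^ 2

/-- A least squares decoder: for every dictionary `X` and channel output `Y` it returns some
minimiser of `‖Y - X β‖²` over the codebook. Ties may be broken arbitrarily. -/
def IsLeastSquaresDecoder {n L M : ℕ}
    (dec : (Fin n → Fin L × Fin M → ℝ) → (Fin n → ℝ) → (Fin L × Fin M → ℝ)) : Prop :=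
  ∀ X Y, dec X Y ∈ codebook L M ∧
    ∀ β ∈ codebook L M, sqNorm (Y - codeword X (dec X Y)) ≤ sqNorm (Y - codeword X β)

/-- The number of sections in which two coefficient vectors differ (for vectors of the
codebook: in which the position of the nonzero element differs). -/
def mistakes {L M : ℕ} (β β' : Fin L × Fin M → ℝ) : ℕ :=
  {s : Fin L | ∃ p : Fin M, β (s, p) ≠ β' (s, p)}.ncard

/-- The law of one entry of the dictionary: `±√(P/L)` with probability `1/2` each. -/
def entryLaw (L : ℕ) (P : ℝ) : Measure ℝ :=
  (2⁻¹ : ENNReal) • Measure.dirac (-√(P / L)) + (2⁻¹ : ENNReal) • Measure.dirac (√(P / L))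

instance (L : ℕ) (P : ℝ) : IsProbabilityMeasure (entryLaw L P) :=
  ⟨by simp [entryLaw, ENNReal.inv_two_add_inv_two]⟩

/-- The law of the `n × N` Bernoulli dictionary, with independent entries. -/
def dictLaw (n L M : ℕ) (P : ℝ) : Measure (Fin n → Fin L × Fin M → ℝ) :=
  Measure.pi fun _ => Measure.pi fun _ => entryLaw L P

/-- The law of the noise: `n` independent coordinates distributed as `N(0, σ²)`. -/
def noiseLaw (n : ℕ) (σ : ℝ) : Measure (Fin n → ℝ) :=
  Measure.pi fun _ => gaussianReal 0 (σ ^ 2).toNNReal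

/-- The joint law of the dictionary `X` and the (independent) noise `ε`. -/
def jointLaw (n L M : ℕ) (P σ : ℝ) :
    Measure ((Fin n → Fin L × Fin M → ℝ) × (Fin n → ℝ)) :=
  (dictLaw n L M P).prod (noiseLaw n σ)

/-- The event `E_l` that, when `β` is sent, i.e. `Y = X β + ε` is received, the decoder makes
mistakes in exactly `l` sections. -/
def mistakeEvent {n L M : ℕ}
    (dec : (Fin n → Fin L × Fin M → ℝ) → (Fin n → ℝ) → (Fin L × Fin M → ℝ))
    (β : Fin L × Fin M → ℝ) (l : ℕ) :
    Set ((Fin n → Fin L × Fin M → ℝ) × (Fin n → ℝ)) :=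
  {ω | mistakes (dec ω.1 (codeword ω.1 β + ω.2)) β = l}

/-! ### Rate, capacity and exponents (all in nats) -/

/-- The rate `R = (L ln M) / n`, in nats per transmission. -/
def rate (n L M : ℕ) : ℝ := L * Real.log M / n

/-- `C_α = (1/2) ln (1 + α v)`. -/
def capa (v α : ℝ) : ℝ := 1 / 2 * Real.log (1 + α * v)

/-- `D(Δ, q) = max_{λ ≥ 0} {λ Δ + (1/2) ln (1 - λ² q)}`, where `q = 1 - ρ²`. Only those `λ` count
for which the logarithm has a positive argument. (Used with `q > 0` only.) -/
def expD (Δ q : ℝ) : ℝ :=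
  sSup ((fun t : ℝ => t * Δ + 1 / 2 * Real.log (1 - t ^ 2 * q)) ''
    {t | 0 ≤ t ∧ 0 < 1 - t ^ 2 * q})

/-- `D₁(Δ, q) = max_{0 ≤ λ ≤ 1} {λ Δ + (1/2) ln (1 - λ² q)}`, where `q = 1 - ρ²`. Only those `λ`
count for which the logarithm has a positive argument. -/
def expD₁ (Δ q : ℝ) : ℝ :=
  sSup ((fun t : ℝ => t * Δ + 1 / 2 * Real.log (1 - t ^ 2 * q)) ''
    {t | 0 ≤ t ∧ t ≤ 1 ∧ 0 < 1 - t ^ 2 * q})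

/-- `1 - ρ₁² = α (1 - α) v / (1 + α v)`. -/
def oneSubRhoSq₁ (v α : ℝ) : ℝ := α * (1 - α) * v / (1 + α * v)

/-- `1 - ρ₂² = α² v / (1 + α² v)`. -/
def oneSubRhoSq₂ (v α : ℝ) : ℝ := α ^ 2 * v / (1 + α ^ 2 * v)

/-! ### The loss terms -/

/-- `η = √(9 / (8 π e))`. -/
def eta : ℝ := √(9 / (8 * Real.pi * Real.exp 1))

/-- `c_ζ = 1 / (1 + 2ζ)² + 1 / (1 - 2ζ)²`. -/
def cZeta (ζ : ℝ) : ℝ := 1 / (1 + 2 * ζ) ^ 2 + 1 / (1 - 2 * ζ) ^ 2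

/-- The function `φ_ζ(x)`, the maximum of three terms. -/
def phiZeta (ζ x : ℝ) : ℝ :=
  max ((3 / 16 * cZeta ζ ^ 2 + 1 / 12) * (1 / x))
    (max (-(4 * ζ ^ 4 / 3) * x + Real.log (x / 2) + 1 / (12 * x))
      (-(Real.log 2 - 1 / 2) * x + 1 / 2 * Real.log (Real.pi * x / 2)))

/-- `φ(x) = inf_{ζ ∈ (0, 1/2)} φ_ζ(x)`. -/
def phi (x : ℝ) : ℝ := sInf ((fun ζ => phiZeta ζ x) '' Set.Ioo 0 (1 / 2))

/-- `ι₃`, where `1 + ι₃` is the maximum over `α₀ L ≤ l ≤ L`. -/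
def iota₃ (L : ℕ) (v α₀ : ℝ) : ℝ :=
  sSup ((fun l : ℕ => Real.exp (phi l) * (1 + eta * (1 + v) / l)) ''
    {l : ℕ | α₀ * L ≤ l ∧ (l : ℝ) ≤ L}) - 1

/-- `ι₄`, where `1 + ι₄` is the maximum over `α₀ L ≤ l ≤ L - √L`. If there is no such `l`, then
`sSup ∅ = 0` and so `ι₄ = -1`; since `ι₅ > 0`, it then drops out of `max {ι₄, ι₅}`. -/
def iota₄ (L : ℕ) (α₀ : ℝ) : ℝ :=
  sSup ((fun l : ℕ => Real.exp (phi l + phi ((L : ℝ) - l)) *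
      (1 + eta / l) * (1 + eta / ((L : ℝ) - l))) ''
    {l : ℕ | α₀ * L ≤ l ∧ (l : ℝ) ≤ L - √L}) - 1

/-- `ι₅`, where `1 + ι₅` is the maximum over `L - √L ≤ l ≤ L - 1`. -/
def iota₅ (L : ℕ) : ℝ :=
  sSup ((fun l : ℕ => Real.exp (phi l) / √(1 - 1 / √L) * (1 + eta / l)) ''
    {l : ℕ | (L : ℝ) - √L ≤ l ∧ (l : ℝ) ≤ L - 1}) - 1

/-- `ι₁ = ln ((1 + ι₃) (1 + max {ι₄, ι₅}))`. -/
def iota₁ (L : ℕ) (v α₀ : ℝ) : ℝ :=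
  Real.log ((1 + iota₃ L v α₀) * (1 + max (iota₄ L α₀) (iota₅ L)))

/-- `ι₂ = φ(L) + ln (1 + 2η / L)`. -/
def iota₂ (L : ℕ) : ℝ := phi L + Real.log (1 + 2 * eta / L)

/-- The bound `err_Ber(α)` at `α = l / L`, as a function of `t = t_α`. -/
def errBer (n L M : ℕ) (v α₀ : ℝ) (l : ℕ) (t : ℝ) : ℝ :=
  (L.choose l : ℝ) *
      Real.exp (-n * (expD₁ (capa v (l / L) - l / L * rate n L M - t)
        (oneSubRhoSq₁ v (l / L)) - iota₁ L v α₀)) +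
    Real.exp (-n * (expD t (oneSubRhoSq₂ v (l / L)) - iota₂ L))

end

end SparseSuperposition

open SparseSuperposition

/-!
Write `w = σ²`, `α = l / L`. If `l` sections are decoded wrongly, some wrong codeword is at least as
close to the output `Y` as the one sent. Comparing both with the codeword shrunk by `1 - α`, either
`‖Y - (1 - α) X β‖² / (w + α² P) - ‖ε‖² / w ≤ -2 n t`, or some wrong codeword has normalised squared
residual at most `‖Y - (1 - α) X β‖² / (w + α² P) + 2 n t`. The first event is bounded by Chernoff's
method with parameter `λ` (called `r` below). For the second, the set of wrong sections is fixed at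
the price of `L.choose l`, and the power `λ ≤ 1` of the sum over the `≤ M ^ l` choices of wrong
columns is compared with the power of its conditional expectation. Instead of Jensen's inequality for
conditional expectations, Young's inequality `exp_mul_le` is used; it leaves only expectations of
products over the `n` independent transmissions (`lintegral_jointLaw_exp_sum`).

Were the dictionary Gaussian, every factor would be a Gaussian integral, equal to
`(1 - λ² (1 - ρ²))^{-1/2}` up to the contribution of the wrong columns. For a Bernoulli dictionary
the sum of the entries of a row over `k` columns is a scaled sum of `k` signs, and the columns are
integrated out group by group:

* the symmetric binomial weights are at most `exp (5 / (6 k))` times the Gaussian density at the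
  lattice points (`choose_le_gaussian`), and `φ(k) ≥ 5 / (6 k)` (`five_div_six_mul_le_phi`);
* the sum of a Gaussian over the lattice exceeds its integral by a theta tail, by Poisson summation
  (`tsum_exp_quadratic_le`), which is at most a multiple of `η / k`; the columns missed by the
  decoder enter with a precision at most twice the original one, and there the tail is small enough
  for the factor `1 + η / k` (`two_mul_thetaTail_le_half`);
* the columns common to both codewords enter log-convexly and cost nothing
  (`signAvg_exp_sq_le`).

The minimum over `t` exists because the exponents are suprema of affine functions with bounded
slopes, hence Lipschitz.
-/

namespace SparseSuperposition

/-! ### Gaussian domination of the symmetric binomial weights -/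

/-- Sharp lower bound for Wallis' product: the sequence `W m (2m+1) / (m + 1/4)`
decreases to `π`. -/
lemma pi_le_wallis (m : ℕ) :
    Real.pi * (m + 1 / 4) ≤ Real.Wallis.W m * (2 * m + 1) := by
  set V : ℕ → ℝ := fun m => Real.Wallis.W m * ((2 * m + 1) / (m + 1 / 4)) with hV
  have hanti : Antitone V := by
    refine antitone_nat_of_succ_le fun k => ?_
    have hW := Real.Wallis.W_pos k
    simp only [hV]
    rw [Real.Wallis.W_succ, mul_assoc]
    refine mul_le_mul_of_nonneg_left ?_ hW.le
    push_cast
    rw [div_mul_div_comm, div_mul_div_comm, div_le_div_iff₀ (by positivity) (by positivity)]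
    have hk : (0 : ℝ) ≤ k := k.cast_nonneg
    nlinarith [pow_nonneg hk 2, pow_nonneg hk 3, pow_nonneg hk 4]
  have hlim : Filter.Tendsto V Filter.atTop (nhds (Real.pi / 2 * 2)) := by
    refine Real.Wallis.tendsto_W_nhds_pi_div_two.mul ?_
    have h1 : Filter.Tendsto (fun m : ℕ => (2 : ℝ) + 1 / 2 / ((m : ℝ) + 1 / 4)) Filter.atTop
        (nhds (2 + 0)) :=
      tendsto_const_nhds.add (tendsto_const_nhds.div_atTop
        (Filter.tendsto_atTop_add_const_right _ _ tendsto_natCast_atTop_atTop))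
    rw [add_zero] at h1
    refine h1.congr fun k => ?_
    have : (k : ℝ) + 1 / 4 ≠ 0 := by positivity
    field_simp
    ring
  have h := hanti.le_of_tendsto hlim m
  simp only [hV] at h
  have h4 : (0 : ℝ) < m + 1 / 4 := by positivity
  rw [← mul_div_assoc, le_div_iff₀ h4] at h
  linarith

lemma centralBinom_div_le (m : ℕ) :
    ((2 * m).choose m : ℝ) / 4 ^ m ≤ √(1 / (Real.pi * (m + 1 / 4))) := by
  refine Real.le_sqrt_of_sq_le ?_
  have h := pi_le_wallis m
  rw [Real.Wallis.W_eq_factorial_ratio] at h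
  have hc : (((2 * m).choose m : ℕ) : ℝ) * (m.factorial) ^ 2 = (2 * m).factorial := by
    have := Nat.choose_mul_factorial_mul_factorial (show m ≤ 2 * m by omega)
    rw [show 2 * m - m = m by omega] at this
    rw [← this]; push_cast; ring
  have hpos : (0 : ℝ) < (2 * m).choose m := by
    exact_mod_cast Nat.choose_pos (by omega)
  have hf : (0 : ℝ) < m.factorial := by exact_mod_cast m.factorial_pos
  rw [← hc] at h
  have h2 : (2 : ℝ) ^ (4 * m) * m.factorial ^ 4 /
      ((((2 * m).choose m : ℝ) * m.factorial ^ 2) ^ 2 * (2 * m + 1)) * (2 * m + 1) =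
      4 ^ m * 4 ^ m / ((2 * m).choose m : ℝ) ^ 2 := by
    rw [show (2 : ℝ) ^ (4 * m) = 4 ^ m * 4 ^ m by
      rw [← mul_pow, pow_mul]; norm_num]
    field_simp
  rw [h2, le_div_iff₀ (by positivity)] at h
  rw [div_pow, div_le_div_iff₀ (by positivity) (by positivity), pow_two (4 ^ m)]
  linarith

/-- Lower bound for `log (C(l, l/2) / C(l, l/2 - d))`, with `N = (l + 1) / 2`: the sum over the
steps towards the centre of the first two terms of `log ((N + j) / (N - j))`. -/
noncomputable def decay (N d : ℝ) : ℝ := d ^ 2 / N + d ^ 2 * (2 * d ^ 2 - 1) / (12 * N ^ 3)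

/-- With `j = (l - 1) / 2 - k`, the ratio of neighbouring weights is `(N + j) / (N - j)`, and
`decay` changes by twice the first two terms of the series of `artanh (j / N)`. -/
lemma choose_mul_exp_decay_step (l k : ℕ) (hk : 2 * k + 1 ≤ l) :
    (l.choose k : ℝ) * Real.exp (decay ((l + 1) / 2) (l / 2 - k)) ≤
      (l.choose (k + 1) : ℝ) * Real.exp (decay ((l + 1) / 2) (l / 2 - (k + 1 : ℕ))) := by
  have hkR : (2 : ℝ) * k + 1 ≤ l := by exact_mod_cast hk
  set N : ℝ := (l + 1) / 2 with hN
  set j : ℝ := (l - 1) / 2 - k with hj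
  have hN0 : 0 < N := by positivity
  have hj0 : 0 ≤ j := by rw [hj]; linarith
  have hNj : N - j = k + 1 := by rw [hN, hj]; ring
  have hNj' : N + j = l - k := by rw [hN, hj]; ring
  have hk0 : (0 : ℝ) ≤ k := k.cast_nonneg
  have hx1 : j / N < 1 := by rw [div_lt_one hN0]; linarith
  have hlog := Real.sum_range_le_log_div (div_nonneg hj0 hN0.le) hx1 2
  have hq : (1 + j / N) / (1 - j / N) = ((l : ℝ) - k) / (k + 1) := by
    rw [← hNj, ← hNj']
    have : N - j ≠ 0 := by rw [hNj]; positivity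
    have : 1 - j / N ≠ 0 := by linarith
    field_simp
  rw [hq] at hlog
  norm_num [Finset.sum_range_succ] at hlog
  have hchoose : (l.choose (k + 1) : ℝ) = l.choose k * ((l - k) / (k + 1)) := by
    have := Nat.choose_succ_right_eq l k
    have h' : (l.choose (k + 1) : ℝ) * (k + 1) = l.choose k * (l - k) := by
      have h2 : ((l - k : ℕ) : ℝ) = l - k := Nat.cast_sub (by omega)
      rw [← h2]; exact_mod_cast this
    rw [mul_div_assoc', ← h', mul_div_cancel_right₀ _ (by positivity)]
  have hdiff : decay N (l / 2 - k) =
      decay N (l / 2 - (k + 1 : ℕ)) + 2 * (j / N + (j / N) ^ 3 / 3) := by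
    have : (l : ℝ) / 2 = j + 1 / 2 + k := by rw [hj]; ring
    rw [this]
    unfold decay
    push_cast
    field_simp
    ring
  have hpos : 0 < ((l : ℝ) - k) / (k + 1) := by
    apply div_pos <;> linarith
  rw [hchoose, hdiff, Real.exp_add, mul_assoc]
  refine mul_le_mul_of_nonneg_left ?_ (by positivity)
  rw [mul_comm]
  refine mul_le_mul_of_nonneg_right ?_ (Real.exp_pos _).le
  rw [← Real.le_log_iff_exp_le hpos]
  linarith

lemma choose_mul_exp_decay_le (l k i : ℕ) (hk : 2 * (k + i) ≤ l + 1) :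
    (l.choose k : ℝ) * Real.exp (decay ((l + 1) / 2) (l / 2 - k)) ≤
      (l.choose (k + i) : ℝ) * Real.exp (decay ((l + 1) / 2) (l / 2 - (k + i : ℕ))) := by
  induction i with
  | zero => simp
  | succ i ih =>
    exact (ih (by omega)).trans (choose_mul_exp_decay_step l (k + i) (by omega))

lemma choose_even_center_le (m : ℕ) (hm : 1 ≤ m) :
    ((2 * m).choose m : ℝ) / 2 ^ (2 * m) ≤
      √(2 / (Real.pi * (2 * m : ℕ))) * Real.exp (-1 / (4 * (2 * m : ℕ) + 2)) := by
  have h := centralBinom_div_le m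
  rw [pow_mul, show (2 : ℝ) ^ 2 = 4 by norm_num]
  refine h.trans ?_
  have hm0 : (0 : ℝ) < m := by exact_mod_cast hm
  have he := Real.one_sub_le_exp_neg (1 / (4 * (m : ℝ) + 1))
  rw [show Real.exp (-1 / (4 * ((2 * m : ℕ) : ℝ) + 2)) = √(Real.exp (-(1 / (4 * (m : ℝ) + 1)))) by
    rw [← Real.exp_half]; congr 1; push_cast; field_simp, ← Real.sqrt_mul (by positivity)]
  refine Real.sqrt_le_sqrt ?_
  calc 1 / (Real.pi * (m + 1 / 4)) = 2 / (Real.pi * (2 * m : ℕ)) * (1 - 1 / (4 * (m : ℝ) + 1)) := by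
        push_cast; field_simp; ring
    _ ≤ _ := mul_le_mul_of_nonneg_left he (by positivity)

lemma choose_odd_center_le (m : ℕ) :
    ((2 * m + 1).choose m : ℝ) / 2 ^ (2 * m + 1) ≤
      √(2 / (Real.pi * (2 * m + 1 : ℕ))) * Real.exp (-(3 / 4) / ((2 * m + 1 : ℕ) + 3 / 2)) := by
  have h := centralBinom_div_le (m + 1)
  have hc : ((2 * (m + 1)).choose (m + 1) : ℝ) = 2 * (2 * m + 1).choose m := by
    have h1 := Nat.choose_succ_succ (2 * m + 1) m
    have h2 := Nat.choose_symm_half m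
    rw [h2] at h1
    rw [show 2 * (m + 1) = (2 * m + 1).succ by omega]
    rw [show m + 1 = m.succ from rfl, h1]
    push_cast; ring
  rw [hc] at h
  have he4 : (2 : ℝ) * (2 * m + 1).choose m / 4 ^ (m + 1) =
      ((2 * m + 1).choose m : ℝ) / 2 ^ (2 * m + 1) := by
    rw [show (4 : ℝ) ^ (m + 1) = 2 * 2 ^ (2 * m + 1) by
      rw [pow_succ, pow_succ, pow_mul]; norm_num; ring]
    field_simp
  rw [he4] at h
  refine h.trans ?_
  have hm0 : (0 : ℝ) ≤ m := m.cast_nonneg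
  have he := Real.one_sub_le_exp_neg ((3 / 2) / ((2 * (m : ℝ) + 1) + 3 / 2))
  rw [show Real.exp (-(3 / 4) / (((2 * m + 1 : ℕ) : ℝ) + 3 / 2)) =
      √(Real.exp (-((3 / 2) / ((2 * (m : ℝ) + 1) + 3 / 2)))) by
    rw [← Real.exp_half]; congr 1; push_cast; field_simp; ring, ← Real.sqrt_mul (by positivity)]
  refine Real.sqrt_le_sqrt ?_
  calc 1 / (Real.pi * ((m + 1 : ℕ) + 1 / 4))
      = 2 / (Real.pi * (2 * m + 1 : ℕ)) * (1 - (3 / 2) / ((2 * (m : ℝ) + 1) + 3 / 2)) := by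
        push_cast; field_simp; ring
    _ ≤ _ := mul_le_mul_of_nonneg_left he (by positivity)

/-- The maximum over `s` of the concave quadratic left over after comparing the exponents. -/
lemma sub_decay_le (l s : ℝ) (hl : 0 < l) :
    2 * s / l - (s / ((l + 1) / 2) + s * (2 * s - 1) / (12 * ((l + 1) / 2) ^ 3)) ≤
      3 / 4 * (l + 1) / l ^ 2 * (1 + l / (3 * (l + 1) ^ 2)) ^ 2 := by
  have hsq : 0 ≤ 4 / 3 / (l + 1) ^ 3 *
      (s - 3 / 4 * (l + 1) ^ 2 / l * (1 + l / (3 * (l + 1) ^ 2))) ^ 2 := by positivity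
  refine sub_nonneg.mp (hsq.trans_eq ?_)
  field_simp
  ring

lemma sub_decay_bound_eq (l : ℝ) (hl : 0 < l) :
    3 / 4 * (l + 1) / l ^ 2 * (1 + l / (3 * (l + 1) ^ 2)) ^ 2 =
      (3 * l ^ 2 + 7 * l + 3) ^ 2 / (12 * l ^ 2 * (l + 1) ^ 3) := by
  field_simp
  ring

lemma even_exponent_le (l s : ℝ) (hl : 4 ≤ l) :
    2 * s / l - (s / ((l + 1) / 2) + s * (2 * s - 1) / (12 * ((l + 1) / 2) ^ 3)) +
      -1 / (4 * l + 2) ≤ 5 / (6 * l) := by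
  have h := sub_decay_le l s (by linarith)
  rw [sub_decay_bound_eq l (by linarith)] at h
  have h2 : 5 / (6 * l) - -1 / (4 * l + 2) = (13 * l + 5) / (6 * l * (2 * l + 1)) := by
    field_simp
    ring
  suffices (3 * l ^ 2 + 7 * l + 3) ^ 2 / (12 * l ^ 2 * (l + 1) ^ 3) ≤
      (13 * l + 5) / (6 * l * (2 * l + 1)) by linarith
  obtain ⟨x, rfl⟩ : ∃ x, l = x + 4 := ⟨l - 4, by ring⟩
  have hx : 0 ≤ x := by linarith
  rw [div_le_div_iff₀ (by positivity) (by positivity), ← sub_nonneg]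
  ring_nf
  positivity

lemma odd_exponent_le (l s : ℝ) (hl : 5 ≤ l) :
    2 * s / l - (s / ((l + 1) / 2) + s * (2 * s - 1) / (12 * ((l + 1) / 2) ^ 3)) +
      1 / (2 * (l + 1)) + -(3 / 4) / (l + 3 / 2) ≤ 5 / (6 * l) := by
  have h := sub_decay_le l s (by linarith)
  rw [sub_decay_bound_eq l (by linarith)] at h
  have h2 : 5 / (6 * l) - 1 / (2 * (l + 1)) - -(3 / 4) / (l + 3 / 2) =
      (13 * l ^ 2 + 25 * l + 15) / (6 * l * (l + 1) * (2 * l + 3)) := by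
    field_simp
    ring
  suffices (3 * l ^ 2 + 7 * l + 3) ^ 2 / (12 * l ^ 2 * (l + 1) ^ 3) ≤
      (13 * l ^ 2 + 25 * l + 15) / (6 * l * (l + 1) * (2 * l + 3)) by linarith
  obtain ⟨x, rfl⟩ : ∃ x, l = x + 5 := ⟨l - 5, by ring⟩
  have hx : 0 ≤ x := by linarith
  rw [div_le_div_iff₀ (by positivity) (by positivity), ← sub_nonneg]
  ring_nf
  positivity

/-- Pointwise comparison of the symmetric binomial weights with the Gaussian density, for
`k` in the lower half; the two cases are the parities of `l`. -/
lemma choose_le_gaussian_of_le_half (l k : ℕ) (hl : 1 ≤ l) (hk : 2 * k ≤ l) :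
    (l.choose k : ℝ) / 2 ^ l ≤ √(2 / (Real.pi * l)) *
      Real.exp (-(2 * k - l) ^ 2 / (2 * l) + 5 / (6 * l)) := by
  have hl0 : (0 : ℝ) < l := by exact_mod_cast hl
  set d : ℝ := (l : ℝ) / 2 - k with hd
  have hdd : -(2 * (k : ℝ) - l) ^ 2 / (2 * l) = -(2 * d ^ 2 / l) := by
    rw [hd]; field_simp; ring
  -- It is enough to bound the weight at the centre and to compare exponents.
  have key : ∀ A e : ℝ, (l.choose k : ℝ) * Real.exp (decay ((l + 1) / 2) d) ≤ A * 2 ^ l →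
      A ≤ √(2 / (Real.pi * l)) * Real.exp e →
      2 * d ^ 2 / l - decay ((l + 1) / 2) d + e ≤ 5 / (6 * l) →
      (l.choose k : ℝ) / 2 ^ l ≤ √(2 / (Real.pi * l)) *
        Real.exp (-(2 * k - l) ^ 2 / (2 * l) + 5 / (6 * l)) := by
    intro A e h1 h2 h3
    rw [hdd, div_le_iff₀ (by positivity)]
    have h4 : (l.choose k : ℝ) ≤ A * 2 ^ l * Real.exp (-decay ((l + 1) / 2) d) := by
      rw [Real.exp_neg, ← div_eq_mul_inv, le_div_iff₀ (Real.exp_pos _)]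
      exact h1
    refine h4.trans ?_
    rw [mul_right_comm]
    refine mul_le_mul_of_nonneg_right ?_ (by positivity)
    refine (mul_le_mul_of_nonneg_right h2 (Real.exp_pos _).le).trans ?_
    rw [mul_assoc, ← Real.exp_add]
    refine mul_le_mul_of_nonneg_left (Real.exp_le_exp.mpr ?_) (Real.sqrt_nonneg _)
    linarith
  have hdecay : decay (((l : ℝ) + 1) / 2) d = d ^ 2 / (((l : ℝ) + 1) / 2) +
      d ^ 2 * (2 * d ^ 2 - 1) / (12 * (((l : ℝ) + 1) / 2) ^ 3) := rfl
  obtain ⟨m, hm | hm⟩ := Nat.even_or_odd' l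
  · have h1 := choose_mul_exp_decay_le l k (m - k) (by omega)
    rw [show k + (m - k) = m by omega] at h1
    have hz : (l : ℝ) / 2 - m = 0 := by rw [hm]; push_cast; ring
    rw [hz, show decay (((l : ℝ) + 1) / 2) 0 = 0 by simp [decay], Real.exp_zero, mul_one] at h1
    have h2 := choose_even_center_le m (by omega)
    rw [← hm] at h2
    refine key ((l.choose m : ℝ) / 2 ^ l) _ ?_ h2 ?_
    · rwa [div_mul_cancel₀ _ (by positivity)]
    · rw [hdecay]
      by_cases h4 : 4 ≤ l
      · exact even_exponent_le l _ (by exact_mod_cast h4)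
      · obtain rfl : l = 2 := by omega
        have : k = 0 ∨ k = 1 := by omega
        rcases this with rfl | rfl <;> norm_num [hd]
  · have h1 := choose_mul_exp_decay_le l k (m - k) (by omega)
    rw [show k + (m - k) = m by omega] at h1
    have hz : (l : ℝ) / 2 - m = 1 / 2 := by rw [hm]; push_cast; ring
    rw [hz] at h1
    have h2 := choose_odd_center_le m
    rw [← hm] at h2
    have hc : decay (((l : ℝ) + 1) / 2) (1 / 2) ≤ 1 / (2 * (l + 1)) := by
      have : decay (((l : ℝ) + 1) / 2) (1 / 2) =
          1 / (2 * (l + 1)) - 1 / (12 * ((l : ℝ) + 1) ^ 3) := by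
        unfold decay; field_simp; ring
      rw [this]
      have : 0 ≤ 1 / (12 * ((l : ℝ) + 1) ^ 3) := by positivity
      linarith
    refine key ((l.choose m : ℝ) / 2 ^ l * Real.exp (1 / (2 * (l + 1))))
      (1 / (2 * (l + 1)) + -(3 / 4) / (l + 3 / 2)) ?_ ?_ ?_
    · rw [mul_right_comm, div_mul_cancel₀ _ (by positivity)]
      exact h1.trans (mul_le_mul_of_nonneg_left (Real.exp_le_exp.mpr hc) (by positivity))
    · rw [Real.exp_add, mul_left_comm, mul_comm]
      exact mul_le_mul_of_nonneg_left h2 (by positivity)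
    · rw [hdecay, ← add_assoc]
      by_cases h5 : 5 ≤ l
      · exact odd_exponent_le l _ (by exact_mod_cast h5)
      · have : l = 1 ∨ l = 3 := by omega
        rcases this with rfl | rfl
        · obtain rfl : k = 0 := by omega
          norm_num [hd]
        · have : k = 0 ∨ k = 1 := by omega
          rcases this with rfl | rfl <;> norm_num [hd]

/-- The binomial weights with `p = 1/2` exceed the Gaussian density at the corresponding lattice
point by at most the factor `exp (5 / (6 l))`. -/
theorem choose_le_gaussian (l k : ℕ) (hl : 1 ≤ l) (hk : k ≤ l) :
    (l.choose k : ℝ) / 2 ^ l ≤ √(2 / (Real.pi * l)) *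
      Real.exp (-(2 * k - l) ^ 2 / (2 * l) + 5 / (6 * l)) := by
  by_cases h : 2 * k ≤ l
  · exact choose_le_gaussian_of_le_half l k hl h
  · have h' := choose_le_gaussian_of_le_half l (l - k) hl (by omega)
    rw [Nat.choose_symm hk, Nat.cast_sub hk] at h'
    convert h' using 4
    ring

/-- The only property of `φ` that matters: as `c_ζ ≥ 2`, its first branch alone gives
`φ(x) ≥ 5 / (6 x)`. -/
lemma five_div_six_mul_le_phi {x : ℝ} (hx : 0 < x) : 5 / (6 * x) ≤ phi x := by
  refine le_csInf ⟨_, 1 / 4, by norm_num, rfl⟩ ?_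
  rintro _ ⟨ζ, ⟨h0, h1⟩, rfl⟩
  refine le_trans ?_ (le_max_left _ _)
  have hc : 2 ≤ cZeta ζ := by
    have h2 : 0 < 1 - 2 * ζ := by linarith
    have h3 : 0 < 1 + 2 * ζ := by linarith
    unfold cZeta
    rw [div_add_div _ _ (by positivity) (by positivity), le_div_iff₀ (by positivity)]
    nlinarith [mul_nonneg (sq_nonneg ζ) (mul_pos h2 h3).le, sq_nonneg ζ]
  have : 5 / (6 * x) = (3 / 16 * 2 ^ 2 + 1 / 12) * (1 / x) := by field_simp; norm_num
  rw [this]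
  gcongr

lemma phi_nonneg {x : ℝ} (hx : 0 < x) : 0 ≤ phi x :=
  le_trans (by positivity) (five_div_six_mul_le_phi hx)

/-! ### Gaussian sums over a lattice -/

/-- The one-sided tail `∑_{k ≥ 1} exp (-π² k² y / 2)` of the theta series: the relative error of
the Riemann sum of a Gaussian over a lattice, where `y` measures how fine the lattice is. -/
noncomputable def thetaTail (y : ℝ) : ℝ :=
  ∑' n : ℕ, Real.exp (-(Real.pi ^ 2 * ((n : ℝ) + 1) ^ 2 * y / 2))

lemma exp_neg_le_inv {z : ℝ} (hz : 0 < z) : Real.exp (-z) ≤ 1 / (Real.exp 1 * z) := by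
  rw [le_div_iff₀ (by positivity)]
  have h : z ≤ Real.exp (z - 1) := by linarith [Real.add_one_le_exp (z - 1)]
  calc Real.exp (-z) * (Real.exp 1 * z) ≤ Real.exp (-z) * (Real.exp 1 * Real.exp (z - 1)) := by
        gcongr
    _ = 1 := by rw [← Real.exp_add, ← Real.exp_add]; simp

lemma exp_neg_le_inv_sq {z : ℝ} (hz : 0 < z) :
    Real.exp (-z) ≤ 4 / (Real.exp 1 ^ 2 * z ^ 2) := by
  have h := exp_neg_le_inv (half_pos hz)
  calc Real.exp (-z) = Real.exp (-(z / 2)) ^ 2 := by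
        rw [← Real.exp_nat_mul]; congr 1; push_cast; ring
    _ ≤ (1 / (Real.exp 1 * (z / 2))) ^ 2 := by gcongr
    _ = _ := by field_simp; norm_num

lemma summable_thetaTail {y : ℝ} (hy : 0 < y) :
    Summable fun n : ℕ => Real.exp (-(Real.pi ^ 2 * ((n : ℝ) + 1) ^ 2 * y / 2)) := by
  have h2 := ((summable_nat_add_iff 1).mpr hasSum_zeta_two.summable).mul_left
    (2 / (Real.exp 1 * Real.pi ^ 2 * y))
  refine Summable.of_nonneg_of_le (fun _ => (Real.exp_pos _).le) (fun n => ?_) h2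
  refine (exp_neg_le_inv (by positivity)).trans_eq ?_
  push_cast
  field_simp

lemma eta_pos : 0 < eta := by
  unfold eta; positivity

lemma two_div_le_eta : 2 / (3 * Real.exp 1) ≤ eta := by
  refine Real.le_sqrt_of_sq_le ?_
  have h1 := Real.pi_lt_d2
  have h2 := Real.exp_one_gt_d9
  rw [div_pow, div_le_div_iff₀ (by positivity) (by positivity)]
  have h3 : 32 * Real.pi ≤ 81 * Real.exp 1 := by linarith
  nlinarith [Real.exp_pos 1]

lemma div_exp_sq_le_eta : 128 / (90 * Real.exp 1 ^ 2) ≤ eta := by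
  refine Real.le_sqrt_of_sq_le ?_
  have h1 := Real.pi_lt_d2
  have h2 := Real.exp_one_gt_d9
  have h3 : (2.7 : ℝ) ^ 3 ≤ Real.exp 1 ^ 3 := by gcongr; linarith
  rw [div_pow, div_le_div_iff₀ (by positivity) (by positivity)]
  have h4 : 128 ^ 2 * 8 * Real.pi ≤ 9 * 8100 * Real.exp 1 ^ 3 := by norm_num at h3 ⊢; linarith
  nlinarith [mul_le_mul_of_nonneg_left h4 (Real.exp_pos 1).le]

/-- Bound for lattices of any mesh, from `exp (-z) ≤ 1 / (e z)` and the value of `ζ(2)`. -/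
lemma two_mul_thetaTail_le {y : ℝ} (hy : 0 < y) : 2 * thetaTail y ≤ eta / y := by
  have h2 := ((hasSum_nat_add_iff' 1).mpr hasSum_zeta_two).mul_left
    (2 / (Real.exp 1 * Real.pi ^ 2 * y))
  have h : thetaTail y ≤ 2 / (Real.exp 1 * Real.pi ^ 2 * y) * (Real.pi ^ 2 / 6) := by
    have := hasSum_le (fun n => ?_) (summable_thetaTail hy).hasSum h2
    · rw [Finset.sum_range_one, Nat.cast_zero] at this
      simpa [thetaTail] using this
    · refine (exp_neg_le_inv (by positivity)).trans_eq ?_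
      push_cast
      field_simp
  have h3 := two_div_le_eta
  rw [le_div_iff₀ hy]
  refine le_trans ?_ h3
  calc 2 * thetaTail y * y ≤ 2 * (2 / (Real.exp 1 * Real.pi ^ 2 * y) * (Real.pi ^ 2 / 6)) * y := by
        gcongr
    _ = _ := by field_simp; norm_num

/-- Bound with half the constant for `y ≥ 1/2`, from `exp (-z) ≤ 4 / (e z)²` and the value of
`ζ(4)`. -/
lemma two_mul_thetaTail_le_half {y : ℝ} (hy : 1 / 2 ≤ y) : 2 * thetaTail y ≤ eta / (2 * y) := by
  have hy0 : 0 < y := by linarith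
  have h2 := ((hasSum_nat_add_iff' 1).mpr hasSum_zeta_four).mul_left
    (16 / (Real.exp 1 ^ 2 * Real.pi ^ 4 * y ^ 2))
  have h : thetaTail y ≤ 16 / (Real.exp 1 ^ 2 * Real.pi ^ 4 * y ^ 2) * (Real.pi ^ 4 / 90) := by
    have := hasSum_le (fun n => ?_) (summable_thetaTail hy0).hasSum h2
    · rw [Finset.sum_range_one, Nat.cast_zero] at this
      simpa only [thetaTail, ne_eq, OfNat.ofNat_ne_zero, not_false_eq_true, zero_pow, div_zero,
        sub_zero] using this
    · refine (exp_neg_le_inv_sq (by positivity)).trans_eq ?_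
      push_cast
      field_simp
      norm_num
  rw [le_div_iff₀ (by positivity)]
  refine le_trans ?_ div_exp_sq_le_eta
  calc 2 * thetaTail y * (2 * y)
      ≤ 2 * (16 / (Real.exp 1 ^ 2 * Real.pi ^ 4 * y ^ 2) * (Real.pi ^ 4 / 90)) * (2 * y) := by
        gcongr
    _ = 64 / (90 * Real.exp 1 ^ 2) / y := by field_simp; norm_num
    _ ≤ 64 / (90 * Real.exp 1 ^ 2) / (1 / 2) := by gcongr
    _ = _ := by field_simp; norm_num

lemma summable_exp_quadratic {a : ℝ} (ha : 0 < a) (b : ℝ) :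
    Summable fun n : ℤ => Real.exp (-Real.pi * a * n ^ 2 + 2 * Real.pi * b * n) := by
  have h := (summable_jacobiTheta₂_term_iff (-Complex.I * b) (Complex.I * a)).mpr
    (by simpa using ha)
  refine h.norm.congr fun n => ?_
  rw [jacobiTheta₂_term, Complex.norm_exp]
  congr 1
  have : 2 * (Real.pi : ℂ) * Complex.I * n * (-Complex.I * b) +
      Real.pi * Complex.I * n ^ 2 * (Complex.I * a) =
      ((-Real.pi * a * n ^ 2 + 2 * Real.pi * b * n : ℝ) : ℂ) := by
    push_cast
    linear_combination (-2 * Real.pi * b * n + Real.pi * a * n ^ 2 : ℂ) * Complex.I_sq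
  rw [this, Complex.ofReal_re]

/-- Poisson summation: the sum of a Gaussian over the integers, whatever its centre, exceeds its
integral by at most the relative amount `2 * thetaTail`. -/
lemma tsum_exp_quadratic_le {a : ℝ} (ha : 0 < a) (b : ℝ) :
    ∑' n : ℤ, Real.exp (-Real.pi * a * n ^ 2 + 2 * Real.pi * b * n) ≤
      (√a)⁻¹ * Real.exp (Real.pi * b ^ 2 / a) * (1 + 2 * thetaTail (2 / (Real.pi * a))) := by
  have hy : 0 < 2 / (Real.pi * a) := by positivity
  have hS : HasSum (fun n : ℤ => Real.exp (Real.pi * b ^ 2 / a) *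
      Real.exp (-(Real.pi / a * n ^ 2)))
      (Real.exp (Real.pi * b ^ 2 / a) * (1 + 2 * thetaTail (2 / (Real.pi * a)))) := by
    refine HasSum.mul_left _ ?_
    have h1 : HasSum (fun n : ℕ => Real.exp (-(Real.pi / a * (((n : ℤ) + 1 : ℤ) : ℝ) ^ 2)))
        (thetaTail (2 / (Real.pi * a))) := by
      refine (summable_thetaTail hy).hasSum.congr_fun ?_
      intro n
      congr 2
      push_cast
      field_simp
    have h2 : HasSum (fun n : ℕ => Real.exp (-(Real.pi / a * ((-((n : ℤ) + 1) : ℤ) : ℝ) ^ 2)))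
        (thetaTail (2 / (Real.pi * a))) := by
      refine h1.congr_fun fun n => ?_
      congr 3
      push_cast
      ring
    have h3 := HasSum.of_add_one_of_neg_add_one (f := fun n : ℤ =>
      Real.exp (-(Real.pi / a * (n : ℝ) ^ 2))) h1 h2
    rw [Int.cast_zero, zero_pow two_ne_zero, mul_zero, neg_zero, Real.exp_zero] at h3
    rwa [show 1 + 2 * thetaTail (2 / (Real.pi * a)) = thetaTail (2 / (Real.pi * a)) + 1 +
      thetaTail (2 / (Real.pi * a)) by ring]
  have hnorm : ∀ n : ℤ, ‖Complex.exp (-Real.pi / a * (n + Complex.I * b) ^ 2)‖ =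
      Real.exp (Real.pi * b ^ 2 / a) * Real.exp (-(Real.pi / a * n ^ 2)) := by
    intro n
    rw [Complex.norm_exp, ← Real.exp_add]
    congr 1
    have : -(Real.pi : ℂ) / a * (n + Complex.I * b) ^ 2 =
        ((Real.pi * b ^ 2 / a - Real.pi / a * n ^ 2 : ℝ) : ℂ) +
          ((-2 * Real.pi / a * n * b : ℝ) : ℂ) * Complex.I := by
      push_cast
      linear_combination (-(Real.pi : ℂ) / a * b ^ 2) * Complex.I_sq
    rw [this, Complex.add_re, Complex.ofReal_re, Complex.re_ofReal_mul, Complex.I_re]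
    ring
  have hP := Complex.tsum_exp_neg_quadratic (a := (a : ℂ)) (by simpa using ha) (b : ℂ)
  have hL : ((∑' n : ℤ, Real.exp (-Real.pi * a * n ^ 2 + 2 * Real.pi * b * n) : ℝ) : ℂ) =
      ∑' n : ℤ, Complex.exp (-Real.pi * a * n ^ 2 + 2 * Real.pi * b * n) := by
    rw [Complex.ofReal_tsum]
    refine tsum_congr fun n => ?_
    push_cast
    rfl
  rw [← hL] at hP
  have hnn : 0 ≤ ∑' n : ℤ, Real.exp (-Real.pi * a * n ^ 2 + 2 * Real.pi * b * n) :=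
    tsum_nonneg fun _ => (Real.exp_pos _).le
  have hsum : Summable fun n : ℤ =>
      ‖Complex.exp (-Real.pi / a * (n + Complex.I * b) ^ 2)‖ := by
    simpa only [hnorm] using hS.summable
  calc ∑' n : ℤ, Real.exp (-Real.pi * a * n ^ 2 + 2 * Real.pi * b * n)
      = ‖((∑' n : ℤ, Real.exp (-Real.pi * a * n ^ 2 + 2 * Real.pi * b * n) : ℝ) : ℂ)‖ := by
        rw [Complex.norm_real, Real.norm_of_nonneg hnn]
    _ ≤ (√a)⁻¹ * ∑' n : ℤ, ‖Complex.exp (-Real.pi / a * (n + Complex.I * b) ^ 2)‖ := by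
        rw [hP, norm_mul]
        refine mul_le_mul (le_of_eq ?_) (norm_tsum_le_tsum_norm hsum) (norm_nonneg _)
          (by positivity)
        rw [norm_div, norm_one, Complex.norm_cpow_eq_rpow_re_of_pos ha, one_div, Real.sqrt_eq_rpow]
        norm_num
    _ = _ := by
        simp_rw [hnorm]
        rw [hS.tsum_eq, mul_assoc]

/-! ### Averages over random signs -/

/-- The mean of `g (s * W)`, where `W` is a sum of `k` independent uniform signs. -/
noncomputable def signAvg (k : ℕ) (s : ℝ) (g : ℝ → ℝ) : ℝ :=
  ∑ i ∈ Finset.range (k + 1), (k.choose i : ℝ) / 2 ^ k * g ((2 * i - k) * s)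

/-- Against a Gaussian function, an average over `l` signs exceeds the average over the normal law
of the same variance `l s²` at most by a factor made of the pointwise comparison of weights and of
the error of the Riemann sum. Here `a = 1 + b l s²` is the precision of the tilted normal law in
units of the original one. -/
lemma signAvg_exp_quadratic_le (l : ℕ) (hl : 1 ≤ l) (s b c d a : ℝ) (hab : a = 1 + b * (l * s ^ 2))
    (ha : 0 < a) :
    signAvg l s (fun x => Real.exp (-(b * x ^ 2 / 2) + c * x + d)) ≤
      Real.exp (phi l) * (1 + 2 * thetaTail (l / a)) *
        ((√a)⁻¹ * Real.exp (c ^ 2 * (l * s ^ 2) / (2 * a) + d)) := by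
  have hl0 : (0 : ℝ) < l := by exact_mod_cast hl
  set A : ℝ := 2 * a / (Real.pi * l) with hA
  set B : ℝ := (a + c * s) / Real.pi with hB
  have hA0 : 0 < A := by positivity
  have hpi := Real.pi_pos
  have hterm : ∀ i ∈ Finset.range (l + 1), (l.choose i : ℝ) / 2 ^ l *
      Real.exp (-(b * ((2 * i - l) * s) ^ 2 / 2) + c * ((2 * i - l) * s) + d) ≤
      √(2 / (Real.pi * l)) * Real.exp (phi l) * Real.exp (-(a * l / 2) - c * s * l + d) *
        Real.exp (-Real.pi * A * ((i : ℤ) : ℝ) ^ 2 + 2 * Real.pi * B * ((i : ℤ) : ℝ)) := by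
    intro i hi
    have h1 := choose_le_gaussian l i hl (by simpa [Nat.lt_succ_iff] using hi)
    have h2 := five_div_six_mul_le_phi hl0
    refine (mul_le_mul_of_nonneg_right h1 (Real.exp_pos _).le).trans ?_
    rw [mul_assoc, mul_assoc, mul_assoc, ← Real.exp_add, ← Real.exp_add, ← Real.exp_add]
    refine mul_le_mul_of_nonneg_left (Real.exp_le_exp.mpr ?_) (Real.sqrt_nonneg _)
    have h3 : -(2 * (i : ℝ) - l) ^ 2 / (2 * l) +
        (-(b * ((2 * i - l) * s) ^ 2 / 2) + c * ((2 * i - l) * s) + d) =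
        -(a * l / 2) - c * s * l + d +
          (-Real.pi * A * ((i : ℤ) : ℝ) ^ 2 + 2 * Real.pi * B * ((i : ℤ) : ℝ)) := by
      rw [hA, hB, hab]
      push_cast
      field_simp
      ring
    linarith
  have hsum := summable_exp_quadratic hA0 B
  have h4 : ∑ i ∈ Finset.range (l + 1),
      Real.exp (-Real.pi * A * ((i : ℤ) : ℝ) ^ 2 + 2 * Real.pi * B * ((i : ℤ) : ℝ)) ≤
      ∑' n : ℤ, Real.exp (-Real.pi * A * n ^ 2 + 2 * Real.pi * B * n) := by
    have h := hsum.sum_le_tsum ((Finset.range (l + 1)).map Nat.castEmbedding)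
      fun _ _ => (Real.exp_pos _).le
    rwa [Finset.sum_map] at h
  have h5 := h4.trans (tsum_exp_quadratic_le hA0 B)
  refine (Finset.sum_le_sum hterm).trans ?_
  rw [← Finset.mul_sum]
  refine (mul_le_mul_of_nonneg_left h5 (by positivity)).trans_eq ?_
  have h6 : 2 / (Real.pi * A) = l / a := by rw [hA]; field_simp
  have h7 : √(2 / (Real.pi * l)) * (√A)⁻¹ = (√a)⁻¹ := by
    rw [← Real.sqrt_inv, ← Real.sqrt_inv, ← Real.sqrt_mul (by positivity)]
    congr 1
    rw [hA]
    field_simp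
  have h8 : c ^ 2 * (l * s ^ 2) / (2 * a) + d =
      -(a * l / 2) - c * s * l + d + Real.pi * B ^ 2 / A := by
    rw [hA, hB]
    field_simp
    ring
  rw [h6, h8, Real.exp_add (_ - _ + _) (_ / A), ← h7]
  ring

lemma signAvg_succ (k : ℕ) (s : ℝ) (g : ℝ → ℝ) :
    signAvg (k + 1) s g =
      (signAvg k s (fun x => g (x - s)) + signAvg k s (fun x => g (x + s))) / 2 := by
  unfold signAvg
  have h1 : ∑ i ∈ Finset.range (k + 1 + 1), ((k + 1).choose i : ℝ) / 2 ^ (k + 1) *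
      g ((2 * i - (k + 1 : ℕ)) * s) =
      ∑ i ∈ Finset.range (k + 1), ((k + 1).choose (i + 1) : ℝ) / 2 ^ (k + 1) *
        g ((2 * (i + 1 : ℕ) - (k + 1 : ℕ)) * s) + 1 / 2 ^ (k + 1) * g (-(k + 1 : ℕ) * s) := by
    rw [Finset.sum_range_succ']
    simp
  have h2 : ∑ i ∈ Finset.range (k + 1), (k.choose i : ℝ) / 2 ^ k * g ((2 * i - k) * s - s) =
      ∑ i ∈ Finset.range (k + 1), (k.choose (i + 1) : ℝ) / 2 ^ k *
        g ((2 * (i + 1 : ℕ) - k) * s - s) + 1 / 2 ^ k * g (-k * s - s) := by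
    have h3 := Finset.sum_range_succ (fun i : ℕ => (k.choose i : ℝ) / 2 ^ k *
      g ((2 * i - k) * s - s)) (k + 1)
    rw [Nat.choose_succ_self] at h3
    rw [← add_zero (∑ i ∈ Finset.range (k + 1), (k.choose i : ℝ) / 2 ^ k *
      g ((2 * i - k) * s - s))]
    have h4 : (0 : ℝ) = ((0 : ℕ) : ℝ) / 2 ^ k * g ((2 * (k + 1 : ℕ) - k) * s - s) := by simp
    rw [h4, ← h3, Finset.sum_range_succ']
    simp
  rw [h1, h2, add_right_comm, ← Finset.sum_add_distrib, add_div, Finset.sum_div]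
  congr 1
  · refine Finset.sum_congr rfl fun i _ => ?_
    rw [Nat.choose_succ_succ]
    have e1 : (2 * ((i + 1 : ℕ) : ℝ) - k) * s - s = (2 * (i + 1 : ℕ) - (k + 1 : ℕ)) * s := by
      push_cast; ring
    have e2 : (2 * (i : ℝ) - k) * s + s = (2 * (i + 1 : ℕ) - (k + 1 : ℕ)) * s := by
      push_cast; ring
    beta_reduce
    rw [e1, e2, pow_succ]
    push_cast
    field_simp
    ring
  · have e1 : -(k : ℝ) * s - s = -(k + 1 : ℕ) * s := by push_cast; ring
    rw [e1, pow_succ]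
    field_simp

lemma signAvg_exp_linear (k : ℕ) (s c d : ℝ) :
    signAvg k s (fun x => Real.exp (c * x + d)) = Real.cosh (c * s) ^ k * Real.exp d := by
  induction k generalizing d with
  | zero => simp [signAvg]
  | succ k ih =>
    have e1 : ∀ x, c * (x - s) + d = c * x + (d - c * s) := fun x => by ring
    have e2 : ∀ x, c * (x + s) + d = c * x + (d + c * s) := fun x => by ring
    rw [signAvg_succ]
    simp_rw [e1, e2, ih, Real.exp_add, sub_eq_add_neg, Real.exp_add]
    rw [pow_succ, Real.cosh_eq (c * s)]
    ring

/-! ### Gaussian functions under the normal law -/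

lemma lintegral_exp_quadratic_gaussianReal {v : ℝ} (hv : 0 < v) (b c d a : ℝ)
    (hab : a = 1 + b * v) (ha : 0 < a) :
    ∫⁻ x, ENNReal.ofReal (Real.exp (-(b * x ^ 2 / 2) + c * x + d)) ∂gaussianReal 0 v.toNNReal =
      ENNReal.ofReal ((√a)⁻¹ * Real.exp (c ^ 2 * v / (2 * a) + d)) := by
  have hv0 : v.toNNReal ≠ 0 := by simpa using hv
  have hva : (v / a).toNNReal ≠ 0 := by simpa using div_pos hv ha
  rw [gaussianReal_of_var_ne_zero _ hv0,
    lintegral_withDensity_eq_lintegral_mul _ (measurable_gaussianPDF _ _) (by fun_prop)]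
  have key : ∀ x : ℝ, (gaussianPDF 0 v.toNNReal *
      fun x => ENNReal.ofReal (Real.exp (-(b * x ^ 2 / 2) + c * x + d))) x =
      ENNReal.ofReal ((√a)⁻¹ * Real.exp (c ^ 2 * v / (2 * a) + d)) *
        gaussianPDF (c * v / a) (v / a).toNNReal x := by
    intro x
    simp only [Pi.mul_apply, gaussianPDF, gaussianPDFReal]
    rw [← ENNReal.ofReal_mul (by positivity), ← ENNReal.ofReal_mul (by positivity)]
    congr 1
    rw [Real.coe_toNNReal _ hv.le, Real.coe_toNNReal _ (div_pos hv ha).le]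
    have h1 : (√(2 * Real.pi * v))⁻¹ = (√a)⁻¹ * (√(2 * Real.pi * (v / a)))⁻¹ := by
      rw [← mul_inv, ← Real.sqrt_mul ha.le]
      congr 2
      field_simp
    have h2 : -(x - 0) ^ 2 / (2 * v) + (-(b * x ^ 2 / 2) + c * x + d) =
        (c ^ 2 * v / (2 * a) + d) + -(x - c * v / a) ^ 2 / (2 * (v / a)) := by
      have : b = (a - 1) / v := by rw [hab]; field_simp; ring
      rw [this]
      field_simp
      ring
    rw [h1, mul_assoc, mul_assoc, mul_assoc, ← Real.exp_add, h2, Real.exp_add]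
    ring
  simp_rw [key]
  rw [lintegral_const_mul _ (measurable_gaussianPDF _ _), lintegral_gaussianPDF_eq_one _ hva,
    mul_one]

/-- Against a log-convex quadratic exponential, signs are dominated by the normal law of the same
variance, with no loss: linearise the square by an auxiliary Gaussian and use
`cosh x ≤ exp (x² / 2)`. -/
lemma signAvg_exp_sq_le (k : ℕ) (s g c d a : ℝ) (hg : 0 ≤ g) (hag : a = 1 - g * (k * s ^ 2))
    (ha : 0 < a) :
    signAvg k s (fun x => Real.exp (g * x ^ 2 / 2 + c * x + d)) ≤
      (√a)⁻¹ * Real.exp (c ^ 2 * (k * s ^ 2) / (2 * a) + d) := by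
  rw [← ENNReal.ofReal_le_ofReal_iff (by positivity)]
  have hlin : ∀ x : ℝ, ENNReal.ofReal (Real.exp (g * x ^ 2 / 2 + c * x + d)) =
      ∫⁻ z, ENNReal.ofReal (Real.exp ((c + √g * z) * x + d)) ∂gaussianReal 0 (1 : ℝ).toNNReal := by
    intro x
    have h := lintegral_exp_quadratic_gaussianReal one_pos 0 (√g * x) (c * x + d) 1 (by ring)
      one_pos
    rw [Real.sqrt_one, inv_one, one_mul, mul_pow, Real.sq_sqrt hg] at h
    have e : ∀ z : ℝ, -(0 * z ^ 2 / 2) + √g * x * z + (c * x + d) = (c + √g * z) * x + d :=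
      fun z => by ring
    simp_rw [e] at h
    rw [h]
    congr 2
    ring
  unfold signAvg
  rw [ENNReal.ofReal_sum_of_nonneg fun _ _ => by positivity]
  simp_rw [ENNReal.ofReal_mul (show (0 : ℝ) ≤ (k.choose _ : ℝ) / 2 ^ k by positivity), hlin]
  simp_rw [← lintegral_const_mul' _ _ ENNReal.ofReal_ne_top]
  rw [← lintegral_finsetSum _ fun _ _ => by fun_prop]
  calc _ = ∫⁻ z, ENNReal.ofReal (Real.cosh ((c + √g * z) * s) ^ k * Real.exp d)
          ∂gaussianReal 0 (1 : ℝ).toNNReal := by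
        refine lintegral_congr fun z => ?_
        rw [← signAvg_exp_linear]
        unfold signAvg
        rw [ENNReal.ofReal_sum_of_nonneg fun _ _ => by positivity]
        simp_rw [ENNReal.ofReal_mul (show (0 : ℝ) ≤ (k.choose _ : ℝ) / 2 ^ k by positivity)]
    _ ≤ ∫⁻ z, ENNReal.ofReal (Real.exp (-(-(g * (k * s ^ 2)) * z ^ 2 / 2) +
          c * √g * (k * s ^ 2) * z + (c ^ 2 * (k * s ^ 2) / 2 + d)))
          ∂gaussianReal 0 (1 : ℝ).toNNReal := by
        refine lintegral_mono fun z => ENNReal.ofReal_le_ofReal ?_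
        have h1 := pow_le_pow_left₀ (Real.cosh_pos _).le
          (Real.cosh_le_exp_half_sq ((c + √g * z) * s)) k
        rw [← Real.exp_nat_mul] at h1
        refine (mul_le_mul_of_nonneg_right h1 (Real.exp_pos _).le).trans_eq ?_
        rw [← Real.exp_add]
        congr 1
        have : √g ^ 2 = g := Real.sq_sqrt hg
        linear_combination (k * s ^ 2 * z ^ 2 / 2) * this
    _ = _ := by
        rw [lintegral_exp_quadratic_gaussianReal one_pos _ _ _ a (by rw [hag]; ring) ha]
        congr 3
        rw [mul_pow, mul_pow, Real.sq_sqrt hg]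
        field_simp
        rw [hag]
        ring

/-! ### Sums of entries of one row of the dictionary -/

section Rows

variable {ι : Type*} [Fintype ι] [DecidableEq ι]

/-- Resampling the coordinates outside `J` does not change a product law. -/
lemma measurePreserving_ite (ν : Measure ℝ) [IsProbabilityMeasure ν] (J : Finset ι) :
    MeasurePreserving (fun p : (ι → ℝ) × (ι → ℝ) => fun j => if j ∈ J then p.1 j else p.2 j)
      ((Measure.pi fun _ => ν).prod (Measure.pi fun _ => ν)) (Measure.pi fun _ : ι => ν) := by
  have hm : Measurable
      (fun p : (ι → ℝ) × (ι → ℝ) => fun j => if j ∈ J then p.1 j else p.2 j) := by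
    refine measurable_pi_lambda _ fun j => ?_
    by_cases hj : j ∈ J
    · simp only [hj, if_true]; fun_prop
    · simp only [hj, if_false]; fun_prop
  refine ⟨hm, (Measure.pi_eq fun s hs => ?_).symm⟩
  rw [Measure.map_apply hm (MeasurableSet.univ_pi hs)]
  have : (fun p : (ι → ℝ) × (ι → ℝ) => fun j => if j ∈ J then p.1 j else p.2 j) ⁻¹'
      Set.univ.pi s = (Set.univ.pi fun j => if j ∈ J then s j else Set.univ) ×ˢ
        (Set.univ.pi fun j => if j ∈ J then Set.univ else s j) := by
    ext p
    simp only [Set.mem_preimage, Set.mem_pi, Set.mem_univ, true_imp_iff, Set.mem_prod]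
    refine ⟨fun h => ⟨fun j => ?_, fun j => ?_⟩, fun h j => ?_⟩
    · have := h j; by_cases hj : j ∈ J <;> simp_all
    · have := h j; by_cases hj : j ∈ J <;> simp_all
    · have h1 := h.1 j; have h2 := h.2 j; by_cases hj : j ∈ J <;> simp_all
  rw [this, Measure.prod_prod, Measure.pi_pi, Measure.pi_pi, ← Finset.prod_mul_distrib]
  refine Finset.prod_congr rfl fun j _ => ?_
  by_cases hj : j ∈ J <;> simp [hj]

lemma lintegral_entryLaw (L : ℕ) (P : ℝ) (f : ℝ → ENNReal) (hf : Measurable f) :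
    ∫⁻ x, f x ∂entryLaw L P = 2⁻¹ * f (-√(P / L)) + 2⁻¹ * f (√(P / L)) := by
  unfold entryLaw
  rw [lintegral_add_measure, lintegral_smul_measure, lintegral_smul_measure,
    lintegral_dirac' _ hf, lintegral_dirac' _ hf]
  rfl

/-- The law of one row of the dictionary. -/
noncomputable def rowLaw (ι : Type*) [Fintype ι] (L : ℕ) (P : ℝ) : Measure (ι → ℝ) :=
  Measure.pi fun _ => entryLaw L P

instance (L : ℕ) (P : ℝ) : IsProbabilityMeasure (rowLaw ι L P) := by
  unfold rowLaw; infer_instance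

lemma lintegral_rowLaw_split (L : ℕ) (P : ℝ) (J : Finset ι) {F : (ι → ℝ) → ENNReal}
    (hF : Measurable F) :
    ∫⁻ x, F x ∂rowLaw ι L P =
      ∫⁻ x', ∫⁻ x, F (fun j => if j ∈ J then x j else x' j) ∂rowLaw ι L P ∂rowLaw ι L P := by
  have h := measurePreserving_ite (entryLaw L P) J
  unfold rowLaw
  rw [← h.lintegral_comp hF]
  exact lintegral_prod_symm' _ (hF.comp h.measurable)

/-- The sum of `|J|` entries of a row is distributed as a scaled sum of `|J|` signs. -/
lemma lintegral_sum_rowLaw (L : ℕ) (P : ℝ) (J : Finset ι) (f : ℝ → ℝ) (hf : Measurable f)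
    (hf0 : ∀ x, 0 ≤ f x) :
    ∫⁻ x, ENNReal.ofReal (f (∑ j ∈ J, x j)) ∂rowLaw ι L P =
      ENNReal.ofReal (signAvg J.card (√(P / L)) f) := by
  induction J using Finset.induction_on generalizing f with
  | empty => simp [signAvg]
  | insert j J hj ih =>
    rw [Finset.card_insert_of_notMem hj, signAvg_succ,
      lintegral_rowLaw_split L P {j} (by fun_prop)]
    have h1 : ∀ x' : ι → ℝ, ∫⁻ x, ENNReal.ofReal
        (f (∑ i ∈ insert j J, if i ∈ ({j} : Finset ι) then x i else x' i)) ∂rowLaw ι L P =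
        2⁻¹ * ENNReal.ofReal (f (∑ i ∈ J, x' i - √(P / L))) +
          2⁻¹ * ENNReal.ofReal (f (∑ i ∈ J, x' i + √(P / L))) := by
      intro x'
      have h2 : ∀ x : ι → ℝ, (∑ i ∈ insert j J, if i ∈ ({j} : Finset ι) then x i else x' i) =
          ∑ i ∈ J, x' i + x j := by
        intro x
        rw [Finset.sum_insert hj, add_comm]
        congr 1
        · refine Finset.sum_congr rfl fun i hi => if_neg ?_
          rw [Finset.mem_singleton]
          rintro rfl
          exact hj hi
        · simp
      simp_rw [h2]
      have h3 := (measurePreserving_eval (fun _ : ι => entryLaw L P) j).lintegral_comp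
        (f := fun t => ENNReal.ofReal (f (∑ i ∈ J, x' i + t))) (by fun_prop)
      unfold rowLaw
      rw [h3, lintegral_entryLaw _ _ _ (by fun_prop), sub_eq_add_neg]
    simp_rw [h1]
    rw [lintegral_add_left (by fun_prop), lintegral_const_mul _ (by fun_prop),
      lintegral_const_mul _ (by fun_prop), ih (fun t => f (t - √(P / L))) (by fun_prop)
      (fun _ => hf0 _), ih (fun t => f (t + √(P / L))) (by fun_prop) (fun _ => hf0 _),
      ← mul_add]
    have h0 : ∀ g : ℝ → ℝ, (∀ x, 0 ≤ g x) → 0 ≤ signAvg J.card (√(P / L)) g := fun g hg =>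
      Finset.sum_nonneg fun _ _ => mul_nonneg (by positivity) (hg _)
    rw [← ENNReal.ofReal_add (h0 _ fun _ => hf0 _) (h0 _ fun _ => hf0 _),
      ENNReal.ofReal_div_of_pos two_pos, ENNReal.ofReal_ofNat, ENNReal.div_eq_inv_mul]

/-- Integrating out the entries of a row in the columns `J`: the rest of the row, on which `g` and
`h` depend, is kept fixed. -/
lemma lintegral_rowLaw_le (L : ℕ) (P : ℝ) (J : Finset ι) (g : (ι → ℝ) → ℝ → ℝ)
    (h : (ι → ℝ) → ℝ) (hg : Measurable fun p : (ι → ℝ) × ℝ => g p.1 p.2)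
    (hg0 : ∀ x t, 0 ≤ g x t)
    (hgJ : ∀ x y : ι → ℝ, (∀ j ∉ J, x j = y j) → g x = g y)
    (hgh : ∀ x, signAvg J.card (√(P / L)) (g x) ≤ h x) :
    ∫⁻ x, ENNReal.ofReal (g x (∑ j ∈ J, x j)) ∂rowLaw ι L P ≤
      ∫⁻ x, ENNReal.ofReal (h x) ∂rowLaw ι L P := by
  have hm : Measurable fun x : ι → ℝ => ENNReal.ofReal (g x (∑ j ∈ J, x j)) := by
    have : Measurable fun x : ι → ℝ => (x, ∑ j ∈ J, x j) := by fun_prop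
    exact (hg.comp this).ennreal_ofReal
  rw [lintegral_rowLaw_split L P J hm]
  refine lintegral_mono fun x' => ?_
  have h1 : ∀ x : ι → ℝ, g (fun j => if j ∈ J then x j else x' j)
      (∑ j ∈ J, if j ∈ J then x j else x' j) = g x' (∑ j ∈ J, x j) := by
    intro x
    rw [hgJ _ x' fun j hj => if_neg hj]
    congr 1
    exact Finset.sum_congr rfl fun j hj => if_pos hj
  simp_rw [h1]
  have hmx : Measurable (g x') := hg.comp (measurable_const.prodMk measurable_id)
  rw [lintegral_sum_rowLaw L P J _ hmx (hg0 x')]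
  exact ENNReal.ofReal_le_ofReal (hgh x')

lemma card_mul_sq_entry {L k : ℕ} {P : ℝ} (hL : 0 < L) (hP : 0 < P) :
    (k : ℝ) * √(P / L) ^ 2 = k / L * P := by
  rw [Real.sq_sqrt (by positivity)]
  field_simp

/-! ### The tilted moments of one transmission -/

/-- Comparison of the true output with the output shrunk towards `(1 - α)` times the codeword. The
Gaussian value of the moment is `(1 - λ² q)^{-1/2}`, `q` being one minus the squared correlation of
`ε` and `ε + α S`. -/
lemma lintegral_noise_vs_shrunk_le (L : ℕ) (hL : 0 < L) (P w α r q s₁ : ℝ) (hP : 0 < P)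
    (hw : 0 < w) (hs₁ : s₁ = w + α ^ 2 * P) (hq : q = α ^ 2 * P / s₁) (hr : 0 ≤ r)
    (hrq : 0 < 1 - r ^ 2 * q) (J : Finset ι) (hJ : J.card = L) :
    ∫⁻ e, ∫⁻ x, ENNReal.ofReal (Real.exp (r / 2 * (e ^ 2 / w -
        (e + α * ∑ j ∈ J, x j) ^ 2 / s₁))) ∂rowLaw ι L P ∂gaussianReal 0 w.toNNReal ≤
      ENNReal.ofReal (Real.exp (phi L) * (1 + 2 * eta / L) * (√(1 - r ^ 2 * q))⁻¹) := by
  have hs0 : 0 < s₁ := by rw [hs₁]; positivity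
  have hL0 : (0 : ℝ) < L := by exact_mod_cast hL
  have hq0 : 0 ≤ q := by rw [hq]; positivity
  have hq1 : q ≤ 1 := by rw [hq, div_le_one hs0, hs₁]; linarith
  have hrq1 : r * q ≤ 1 := by
    have h1 : (r * q) ^ 2 ≤ 1 ^ 2 := by nlinarith [mul_nonneg (sq_nonneg r) hq0]
    exact le_of_sq_le_sq h1 one_pos.le
  set a : ℝ := 1 + r * q with ha
  have ha0 : 0 < a := by positivity
  have hab : a = 1 + r * α ^ 2 / s₁ * (L * √(P / L) ^ 2) := by
    rw [card_mul_sq_entry hL hP, ha, hq]; field_simp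
  set b' : ℝ := -(r * (1 / w - 1 / s₁) + P * (r * α / s₁) ^ 2 / a) with hb'
  have hprod : a * (1 + b' * w) = 1 - r ^ 2 * q := by
    have h1 : s₁ * q = α ^ 2 * P := by rw [hq]; field_simp
    have h2 : w = s₁ * (1 - q) := by rw [mul_sub, h1, hs₁]; ring
    have h3 : w / s₁ = 1 - q := by rw [h2]; field_simp
    have h4 : a * (1 + b' * w) =
        a - a * (r * (1 - w / s₁)) - (α ^ 2 * P / s₁) * r ^ 2 * (w / s₁) := by
      rw [hb']; field_simp; ring
    rw [h4, h3, ← hq, ha]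
    ring
  have hb0 : 0 < 1 + b' * w := by
    rw [← hprod] at hrq
    exact (mul_pos_iff_of_pos_left ha0).mp hrq
  have hF : Real.exp (phi L) * (1 + 2 * thetaTail (L / a)) ≤
      Real.exp (phi L) * (1 + 2 * eta / L) := by
    have h1 := two_mul_thetaTail_le (y := L / a) (by positivity)
    have h2 : eta / (L / a) ≤ 2 * eta / L := by
      rw [div_div_eq_mul_div, mul_comm]
      have := eta_pos
      gcongr
      linarith
    gcongr
    linarith
  have hx : ∀ e : ℝ, ∫⁻ x, ENNReal.ofReal (Real.exp (r / 2 * (e ^ 2 / w -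
        (e + α * ∑ j ∈ J, x j) ^ 2 / s₁))) ∂rowLaw ι L P ≤
      ENNReal.ofReal (Real.exp (phi L) * (1 + 2 * eta / L) * (√a)⁻¹) *
        ENNReal.ofReal (Real.exp (-(b' * e ^ 2 / 2) + 0 * e + 0)) := by
    intro e
    have h1 := lintegral_sum_rowLaw L P J
      (fun t => Real.exp (-(r * α ^ 2 / s₁ * t ^ 2 / 2) + -(r * α * e / s₁) * t +
        r / 2 * e ^ 2 * (1 / w - 1 / s₁))) (by fun_prop) (fun _ => (Real.exp_pos _).le)
    have h2 : ∀ t : ℝ, -(r * α ^ 2 / s₁ * t ^ 2 / 2) + -(r * α * e / s₁) * t +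
        r / 2 * e ^ 2 * (1 / w - 1 / s₁) = r / 2 * (e ^ 2 / w - (e + α * t) ^ 2 / s₁) := by
      intro t; field_simp; ring
    simp_rw [← h2]
    rw [← ENNReal.ofReal_mul (by have := eta_pos; positivity), h1, hJ]
    refine ENNReal.ofReal_le_ofReal ?_
    refine (signAvg_exp_quadratic_le L hL _ _ _ _ a hab ha0).trans ?_
    rw [card_mul_sq_entry hL hP, div_self hL0.ne', one_mul, ← mul_assoc]
    have h3 : (-(r * α * e / s₁)) ^ 2 * P / (2 * a) + r / 2 * e ^ 2 * (1 / w - 1 / s₁) =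
        -(b' * e ^ 2 / 2) + 0 * e + 0 := by
      rw [hb']; field_simp; ring
    rw [h3]
    gcongr
  refine (lintegral_mono hx).trans ?_
  rw [lintegral_const_mul _ (by fun_prop),
    lintegral_exp_quadratic_gaussianReal hw b' 0 0 _ rfl hb0,
    ← ENNReal.ofReal_mul (by have := eta_pos; positivity), ← hprod, Real.sqrt_mul ha0.le]
  refine le_of_eq ?_
  congr 1
  rw [mul_inv]
  simp
  ring

/-- The columns `C` of a wrong codeword are integrated out: they contribute the factor
`(1 + α v)^{-1/2}` and turn the squared residual into the normalised one of `e + S_B`. -/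
lemma lintegral_wrong_columns_le (L l : ℕ) (hL : 0 < L) (hl : 0 < l) (hlL : l ≤ L)
    (P w r s₂ : ℝ) (hP : 0 < P) (hw : 0 < w) (hs₂ : s₂ = w + l / L * P)
    (B C : Finset ι) (hC : C.card = l) (hBC : Disjoint B C) (u : (ι → ℝ) → ℝ) (hu : Measurable u)
    (huC : ∀ x y : ι → ℝ, (∀ j ∉ C, x j = y j) → u x = u y) (e : ℝ) :
    ∫⁻ x, ENNReal.ofReal (Real.exp (u x + (1 - r) / 2 * ((e + ∑ j ∈ B, x j) ^ 2 / s₂) -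
        (e + ∑ j ∈ B, x j - ∑ j ∈ C, x j) ^ 2 / w / 2)) ∂rowLaw ι L P ≤
      ENNReal.ofReal (Real.exp (phi l) * (1 + eta * (1 + P / w) / l) *
          (√(1 + l / L * (P / w)))⁻¹) *
        ∫⁻ x, ENNReal.ofReal (Real.exp (u x - r / 2 * ((e + ∑ j ∈ B, x j) ^ 2 / s₂)))
          ∂rowLaw ι L P := by
  have hl0 : (0 : ℝ) < l := by exact_mod_cast hl
  have hL0 : (0 : ℝ) < L := by exact_mod_cast hL
  have hs0 : 0 < s₂ := by rw [hs₂]; positivity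
  have he := eta_pos
  have hlL' : (l : ℝ) / L ≤ 1 := by rw [div_le_one hL0]; exact_mod_cast hlL
  set a : ℝ := 1 + l / L * (P / w) with ha
  have ha0 : 0 < a := by positivity
  have haw : a * w = s₂ := by rw [ha, hs₂]; field_simp
  have hF : Real.exp (phi l) * (1 + 2 * thetaTail (l / a)) ≤
      Real.exp (phi l) * (1 + eta * (1 + P / w) / l) := by
    have h1 := two_mul_thetaTail_le (y := l / a) (by positivity)
    have h2 : eta / (l / a) ≤ eta * (1 + P / w) / l := by
      rw [div_div_eq_mul_div, ha]
      have : (l : ℝ) / L * (P / w) ≤ 1 * (P / w) := by gcongr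
      gcongr
      linarith
    gcongr
    linarith
  rw [← lintegral_const_mul' _ _ ENNReal.ofReal_ne_top]
  simp_rw [← ENNReal.ofReal_mul (show 0 ≤ Real.exp (phi l) * (1 + eta * (1 + P / w) / l) *
          (√a)⁻¹ by positivity)]
  refine lintegral_rowLaw_le L P C
    (fun x t => Real.exp (u x + (1 - r) / 2 * ((e + ∑ j ∈ B, x j) ^ 2 / s₂) -
        (e + ∑ j ∈ B, x j - t) ^ 2 / w / 2)) _ (by fun_prop) (fun _ _ => (Real.exp_pos _).le)
    ?_ ?_
  · intro x y hxy
    have h1 : ∑ j ∈ B, x j = ∑ j ∈ B, y j :=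
      Finset.sum_congr rfl fun j hj => hxy j (Finset.disjoint_left.mp hBC hj)
    simp only [h1, huC x y hxy]
  · intro x
    set m : ℝ := e + ∑ j ∈ B, x j
    have h2 : ∀ t : ℝ, u x + (1 - r) / 2 * (m ^ 2 / s₂) - (m - t) ^ 2 / w / 2 =
        -(1 / w * t ^ 2 / 2) + m / w * t +
          (u x + (1 - r) / 2 * (m ^ 2 / s₂) - m ^ 2 / w / 2) := by
      intro t; field_simp; ring
    simp_rw [h2]
    rw [hC]
    refine (signAvg_exp_quadratic_le l hl _ _ _ _ a ?_ ha0).trans ?_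
    · rw [card_mul_sq_entry hL hP, ha]; field_simp
    · rw [card_mul_sq_entry hL hP, ← mul_assoc]
      have h3 : (m / w) ^ 2 * (l / L * P) / (2 * a) +
          (u x + (1 - r) / 2 * (m ^ 2 / s₂) - m ^ 2 / w / 2) =
          u x - r / 2 * (m ^ 2 / s₂) := by
        have h4 : (l : ℝ) / L * P = s₂ - w := by rw [hs₂]; ring
        rw [h4, ← haw]
        field_simp
        ring
      rw [h3]
      gcongr

set_option maxHeartbeats 1000000 in
/-- Comparison of the shrunk residual `e + α (S_A + S_B)` with the residual `e + S_B`, where `B`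
holds the columns sent but not decoded and `A` those sent and decoded. The columns `A` enter
log-convexly and cost nothing; the columns `B` have a precision between `1` and `2`. -/
lemma lintegral_shrunk_vs_missed_le (L l : ℕ) (hl : 0 < l) (hlL : l < L)
    (P w r α q s₁ s₂ : ℝ) (hP : 0 < P) (hw : 0 < w) (hα : α = l / L)
    (hs₁ : s₁ = w + α ^ 2 * P) (hs₂ : s₂ = w + α * P) (hq : q = α * (1 - α) * P / s₂)
    (hr0 : 0 ≤ r) (hr1 : r ≤ 1) (A B : Finset ι) (hA : A.card = L - l) (hB : B.card = l)
    (hAB : Disjoint A B) :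
    ∫⁻ e, ∫⁻ x, ENNReal.ofReal (Real.exp (
        r / 2 * ((e + α * (∑ j ∈ A, x j + ∑ j ∈ B, x j)) ^ 2 / s₁) -
        r / 2 * ((e + ∑ j ∈ B, x j) ^ 2 / s₂))) ∂rowLaw ι L P ∂gaussianReal 0 w.toNNReal ≤
      ENNReal.ofReal (Real.exp (phi l) * (1 + eta / l) * (√(1 - r ^ 2 * q))⁻¹) := by
  have hL : 0 < L := by omega
  have hl0 : (0 : ℝ) < l := by exact_mod_cast hl
  have hL0 : (0 : ℝ) < L := by exact_mod_cast hL
  have hη := eta_pos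
  have hα0 : 0 < α := by rw [hα]; positivity
  have hα1 : α < 1 := by rw [hα, div_lt_one hL0]; exact_mod_cast hlL
  have hs10 : 0 < s₁ := by rw [hs₁]; positivity
  have hs20 : 0 < s₂ := by rw [hs₂]; positivity
  -- `g` is the variance of the shrunk residual after the columns `A` are integrated out.
  set g : ℝ := s₁ - r * α ^ 2 * (1 - α) * P with hg
  have hαP : 0 < α ^ 2 * P := by positivity
  have hgα : α ^ 2 * s₂ ≤ g := by
    rw [hg, hs₁, hs₂]
    have h1 : r * (α ^ 2 * P * (1 - α)) ≤ 1 * (α ^ 2 * P * (1 - α)) :=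
      mul_le_mul_of_nonneg_right hr1 (mul_nonneg hαP.le (by linarith))
    have h2 : α ^ 2 * w ≤ 1 * w := mul_le_mul_of_nonneg_right (by nlinarith) hw.le
    nlinarith
  have hg0 : 0 < g := lt_of_lt_of_le (by positivity) hgα
  set aA : ℝ := g / s₁ with haA
  have haA0 : 0 < aA := by positivity
  set bB : ℝ := r * (1 / s₂ - α ^ 2 / g) with hbB
  set aB : ℝ := 1 + bB * (α * P) with haB
  have hbB0 : 0 ≤ bB := by
    rw [hbB]
    refine mul_nonneg hr0 (sub_nonneg.mpr ?_)
    rw [div_le_div_iff₀ hg0 hs20]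
    linarith
  have haB1 : 1 ≤ aB := by rw [haB]; nlinarith [mul_nonneg hbB0 (mul_pos hα0 hP).le]
  have haB0 : 0 < aB := by linarith
  have haB2 : aB ≤ 2 := by
    have h1 : bB ≤ 1 / s₂ := by
      rw [hbB]
      have h2 : 0 ≤ α ^ 2 / g := by positivity
      have h3 : 0 < 1 / s₂ := by positivity
      nlinarith
    have h4 : bB * (α * P) ≤ 1 / s₂ * (α * P) := by gcongr
    have h5 : 1 / s₂ * (α * P) ≤ 1 := by
      rw [one_div, inv_mul_le_iff₀ hs20, hs₂]; linarith
    rw [haB]; linarith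
  set c₁ : ℝ := r * (α / g - 1 / s₂) with hc₁
  set b' : ℝ := -(r * (1 / g - 1 / s₂) + α * P * c₁ ^ 2 / aB) with hb'
  -- The three successive precisions multiply to the determinant of the full quadratic form.
  have hprod : aA * (aB * (1 + b' * w)) = 1 - r ^ 2 * q := by
    have h1 : aB * (1 + b' * w) =
        aB * (1 - r * (1 / g - 1 / s₂) * w) - α * P * c₁ ^ 2 * w := by
      rw [hb']; field_simp; ring
    have hgne := hg0.ne'
    have h2 : (1 - r ^ 2 * q) = (s₂ - r ^ 2 * (α * (1 - α) * P)) / s₂ := by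
      rw [hq]; field_simp
    rw [h1, h2, haB, hc₁, hbB, haA]
    field_simp
    rw [hg, hs₁, hs₂]
    ring
  have hq1 : 0 < 1 - r ^ 2 * q := by
    have h1 : q < 1 := by
      rw [hq, div_lt_one hs20, hs₂]
      nlinarith [mul_pos hα0 hP, mul_pos hα0 (mul_pos hα0 hP)]
    have h2 : 0 ≤ q := by
      rw [hq]
      exact div_nonneg (mul_nonneg (mul_nonneg hα0.le (by linarith)) hP.le) hs20.le
    nlinarith [mul_le_one₀ hr1 hr0 hr1]
  have hb0 : 0 < 1 + b' * w := by
    rw [← hprod] at hq1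
    exact (mul_pos_iff_of_pos_left haB0).mp ((mul_pos_iff_of_pos_left haA0).mp hq1)
  have hF : Real.exp (phi l) * (1 + 2 * thetaTail (l / aB)) ≤
      Real.exp (phi l) * (1 + eta / l) := by
    have hl1 : (1 : ℝ) ≤ l := by exact_mod_cast hl
    have h1 := two_mul_thetaTail_le_half (y := l / aB) (by
      rw [div_le_div_iff₀ two_pos haB0]; linarith)
    have h2 : eta / (2 * (l / aB)) ≤ eta / l := by
      rw [div_le_div_iff₀ (by positivity) hl0]
      have : (l : ℝ) ≤ 2 * (l / aB) := by
        rw [mul_div_assoc', le_div_iff₀ haB0]; nlinarith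
      gcongr
    gcongr
    linarith
  have hcardA : ((L - l : ℕ) : ℝ) * √(P / L) ^ 2 = (1 - α) * P := by
    rw [card_mul_sq_entry hL hP, Nat.cast_sub hlL.le, hα, sub_div, div_self hL0.ne']
  have hcardB : (l : ℝ) * √(P / L) ^ 2 = α * P := by
    rw [card_mul_sq_entry hL hP, hα]
  have hstepA : ∀ e : ℝ, ∫⁻ x, ENNReal.ofReal (Real.exp (
        r / 2 * ((e + α * (∑ j ∈ A, x j + ∑ j ∈ B, x j)) ^ 2 / s₁) -
        r / 2 * ((e + ∑ j ∈ B, x j) ^ 2 / s₂))) ∂rowLaw ι L P ≤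
      ∫⁻ x, ENNReal.ofReal ((√aA)⁻¹ * Real.exp (r / 2 * ((e + α * ∑ j ∈ B, x j) ^ 2 / g) -
        r / 2 * ((e + ∑ j ∈ B, x j) ^ 2 / s₂))) ∂rowLaw ι L P := by
    intro e
    refine lintegral_rowLaw_le L P A
      (fun x t => Real.exp (r / 2 * ((e + α * (t + ∑ j ∈ B, x j)) ^ 2 / s₁) -
        r / 2 * ((e + ∑ j ∈ B, x j) ^ 2 / s₂))) _ (by fun_prop) (fun _ _ => (Real.exp_pos _).le)
      ?_ ?_
    · intro x y hxy
      have h1 : ∑ j ∈ B, x j = ∑ j ∈ B, y j :=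
        Finset.sum_congr rfl fun j hj => hxy j (Finset.disjoint_right.mp hAB hj)
      simp only [h1]
    · intro x
      set S : ℝ := ∑ j ∈ B, x j
      have h2 : ∀ t : ℝ, r / 2 * ((e + α * (t + S)) ^ 2 / s₁) - r / 2 * ((e + S) ^ 2 / s₂) =
          r * α ^ 2 / s₁ * t ^ 2 / 2 + r * α * (e + α * S) / s₁ * t +
            (r / 2 * ((e + α * S) ^ 2 / s₁) - r / 2 * ((e + S) ^ 2 / s₂)) := by
        intro t; field_simp; ring
      simp_rw [h2]
      rw [hA]
      refine (signAvg_exp_sq_le (L - l) _ _ _ _ aA (by positivity) ?_ haA0).trans_eq ?_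
      · rw [hcardA, haA, hg]; field_simp
      · rw [hcardA]
        congr 2
        have h4 : r * α ^ 2 * (1 - α) * P = s₁ - g := by rw [hg]; ring
        have h5 : (r * α * (e + α * S) / s₁) ^ 2 * ((1 - α) * P) / (2 * aA) =
            (r * α ^ 2 * (1 - α) * P) * (r * (e + α * S) ^ 2) / (2 * s₁ * g) := by
          rw [haA]; field_simp
        rw [h5, h4]
        field_simp
        ring
  have hstepB : ∀ e : ℝ, ∫⁻ x, ENNReal.ofReal ((√aA)⁻¹ * Real.exp (
        r / 2 * ((e + α * ∑ j ∈ B, x j) ^ 2 / g) - r / 2 * ((e + ∑ j ∈ B, x j) ^ 2 / s₂)))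
          ∂rowLaw ι L P ≤
      ENNReal.ofReal ((√aA)⁻¹ * (Real.exp (phi l) * (1 + eta / l) * (√aB)⁻¹)) *
        ENNReal.ofReal (Real.exp (-(b' * e ^ 2 / 2) + 0 * e + 0)) := by
    intro e
    rw [← ENNReal.ofReal_mul (by positivity), mul_assoc,
      ENNReal.ofReal_mul (by positivity)]
    simp_rw [ENNReal.ofReal_mul (show 0 ≤ (√aA)⁻¹ by positivity)]
    rw [lintegral_const_mul' _ _ ENNReal.ofReal_ne_top]
    refine mul_le_mul_right ?_ _
    have h2 : ∀ t : ℝ, r / 2 * ((e + α * t) ^ 2 / g) - r / 2 * ((e + t) ^ 2 / s₂) =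
        -(bB * t ^ 2 / 2) + c₁ * e * t + r / 2 * e ^ 2 * (1 / g - 1 / s₂) := by
      intro t; rw [hbB, hc₁]; field_simp; ring
    rw [lintegral_sum_rowLaw L P B (fun t => Real.exp (r / 2 * ((e + α * t) ^ 2 / g) -
      r / 2 * ((e + t) ^ 2 / s₂))) (by fun_prop) (fun _ => (Real.exp_pos _).le), hB]
    refine ENNReal.ofReal_le_ofReal ?_
    simp_rw [h2]
    refine (signAvg_exp_quadratic_le l hl _ _ _ _ aB (by rw [hcardB]) haB0).trans ?_
    rw [hcardB, ← mul_assoc]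
    have h3 : (c₁ * e) ^ 2 * (α * P) / (2 * aB) + r / 2 * e ^ 2 * (1 / g - 1 / s₂) =
        -(b' * e ^ 2 / 2) + 0 * e + 0 := by
      rw [hb']; field_simp; ring
    rw [h3]
    gcongr
  refine (lintegral_mono fun e => (hstepA e).trans (hstepB e)).trans ?_
  rw [lintegral_const_mul _ (by fun_prop),
    lintegral_exp_quadratic_gaussianReal hw b' 0 0 _ rfl hb0,
    ← ENNReal.ofReal_mul (by positivity), ← hprod, Real.sqrt_mul haA0.le, Real.sqrt_mul haB0.le]
  refine le_of_eq ?_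
  congr 1
  rw [mul_inv, mul_inv]
  simp
  ring

end Rows

/-! ### From one transmission to `n` transmissions -/

/-- The transmissions are independent, so exponential moments factorise. -/
lemma lintegral_jointLaw_exp_sum (n L M : ℕ) (P σ : ℝ) (Q : (Fin L × Fin M → ℝ) → ℝ → ℝ)
    (hQ : Measurable fun p : (Fin L × Fin M → ℝ) × ℝ => Q p.1 p.2) :
    ∫⁻ ω, ENNReal.ofReal (Real.exp (∑ i, Q (ω.1 i) (ω.2 i))) ∂jointLaw n L M P σ =
      (∫⁻ e, ∫⁻ x, ENNReal.ofReal (Real.exp (Q x e)) ∂rowLaw (Fin L × Fin M) L P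
        ∂gaussianReal 0 (σ ^ 2).toNNReal) ^ n := by
  have h := measurePreserving_arrowProdEquivProdArrow (Fin L × Fin M → ℝ) ℝ (Fin n)
    (fun _ => rowLaw (Fin L × Fin M) L P) (fun _ => gaussianReal 0 (σ ^ 2).toNNReal)
  have hjoint : jointLaw n L M P σ = (Measure.pi fun _ : Fin n => rowLaw (Fin L × Fin M) L P).prod
      (Measure.pi fun _ : Fin n => gaussianReal 0 (σ ^ 2).toNNReal) := rfl
  have hm : ∀ i, Measurable fun ω : (Fin n → Fin L × Fin M → ℝ) × (Fin n → ℝ) =>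
      Q (ω.1 i) (ω.2 i) := by
    intro i
    have h1 : Measurable fun ω : (Fin n → Fin L × Fin M → ℝ) × (Fin n → ℝ) => (ω.1 i, ω.2 i) := by
      fun_prop
    exact hQ.comp h1
  rw [hjoint, ← h.lintegral_comp (by fun_prop)]
  have hexp : ∀ z : Fin n → (Fin L × Fin M → ℝ) × ℝ, ENNReal.ofReal (Real.exp (∑ i,
      Q ((MeasurableEquiv.arrowProdEquivProdArrow (Fin L × Fin M → ℝ) ℝ (Fin n) z).1 i)
        ((MeasurableEquiv.arrowProdEquivProdArrow (Fin L × Fin M → ℝ) ℝ (Fin n) z).2 i))) =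
      ∏ i, ENNReal.ofReal (Real.exp (Q (z i).1 (z i).2)) := by
    intro z
    rw [Real.exp_sum, ENNReal.ofReal_prod_of_nonneg fun _ _ => (Real.exp_pos _).le]
    rfl
  simp_rw [hexp]
  have hf : Measurable fun p : (Fin L × Fin M → ℝ) × ℝ => ENNReal.ofReal (Real.exp (Q p.1 p.2)) :=
    (Real.measurable_exp.comp hQ).ennreal_ofReal
  have hind := iIndepFun_pi (ι := Fin n)
    (μ := fun _ => (rowLaw (Fin L × Fin M) L P).prod (gaussianReal 0 (σ ^ 2).toNNReal))
    (X := fun _ p => ENNReal.ofReal (Real.exp (Q p.1 p.2))) (fun _ => hf.aemeasurable)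
  rw [lintegral_prod_eq_prod_lintegral_of_indepFun Finset.univ _ hind
    fun i => hf.comp (measurable_pi_apply i)]
  have heval : ∀ i : Fin n, ∫⁻ z : Fin n → (Fin L × Fin M → ℝ) × ℝ,
      ENNReal.ofReal (Real.exp (Q (z i).1 (z i).2)) ∂(Measure.pi fun _ : Fin n =>
        (rowLaw (Fin L × Fin M) L P).prod (gaussianReal 0 (σ ^ 2).toNNReal)) =
      ∫⁻ e, ∫⁻ x, ENNReal.ofReal (Real.exp (Q x e)) ∂rowLaw (Fin L × Fin M) L P
        ∂gaussianReal 0 (σ ^ 2).toNNReal := by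
    intro i
    have h1 := (measurePreserving_eval (fun _ : Fin n =>
      (rowLaw (Fin L × Fin M) L P).prod (gaussianReal 0 (σ ^ 2).toNNReal)) i).lintegral_comp hf
    rw [← lintegral_prod_symm' _ hf, ← h1]
  simp_rw [heval]
  simp

lemma measure_le_lintegral_of_one_le {Ω : Type*} [MeasurableSpace Ω] (μ : Measure Ω) {S : Set Ω}
    {f : Ω → ENNReal} (hf : Measurable f) (h : ∀ ω ∈ S, 1 ≤ f ω) : μ S ≤ ∫⁻ ω, f ω ∂μ := by
  have h1 := mul_meas_ge_le_lintegral (μ := μ) hf 1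
  rw [one_mul] at h1
  exact (measure_mono h).trans h1

instance (n L M : ℕ) (P σ : ℝ) : IsProbabilityMeasure (jointLaw n L M P σ) := by
  unfold jointLaw dictLaw noiseLaw; infer_instance

/-! ### Codewords as choices of columns -/

section Columns

variable {L M : ℕ}

/-- The columns selected by the choice `p` of positions in the sections of `S`. -/
def columns (p : Fin L → Fin M) (S : Finset (Fin L)) : Finset (Fin L × Fin M) :=
  S.image fun s => (s, p s)

lemma mk_injective (p : Fin L → Fin M) : Function.Injective fun s => (s, p s) :=
  fun _ _ h => congrArg Prod.fst h

lemma card_columns (p : Fin L → Fin M) (S : Finset (Fin L)) : (columns p S).card = S.card :=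
  Finset.card_image_of_injective _ (mk_injective p)

lemma sum_columns (p : Fin L → Fin M) (S : Finset (Fin L)) (x : Fin L × Fin M → ℝ) :
    ∑ j ∈ columns p S, x j = ∑ s ∈ S, x (s, p s) :=
  Finset.sum_image fun _ _ _ _ h => mk_injective p h

lemma disjoint_columns (p p' : Fin L → Fin M) (S S' : Finset (Fin L))
    (h : ∀ s ∈ S, s ∈ S' → p s ≠ p' s) : Disjoint (columns p S) (columns p' S') := by
  rw [Finset.disjoint_left]
  rintro j hj hj'
  simp only [columns, Finset.mem_image] at hj hj'
  obtain ⟨s, hs, rfl⟩ := hj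
  obtain ⟨s', hs', h'⟩ := hj'
  obtain ⟨rfl, h2⟩ := Prod.mk.inj h'
  exact h _ hs hs' h2.symm

lemma exists_choice_of_mem_codebook {β : Fin L × Fin M → ℝ} (hβ : β ∈ codebook L M) :
    ∃ p : Fin L → Fin M, ∀ s q, β (s, q) = if q = p s then 1 else 0 := by
  choose p hp hp' using hβ.2
  refine ⟨p, fun s q => ?_⟩
  split_ifs with h
  · rw [h]; exact hp s
  · rcases hβ.1 (s, q) with h0 | h1
    · exact h0
    · exact absurd (hp' s q h1) h

lemma codeword_eq_sum {n : ℕ} (X : Fin n → Fin L × Fin M → ℝ) {β : Fin L × Fin M → ℝ}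
    {p : Fin L → Fin M} (hp : ∀ s q, β (s, q) = if q = p s then 1 else 0) (i : Fin n) :
    codeword X β i = ∑ s, X i (s, p s) := by
  unfold codeword
  rw [Fintype.sum_prod_type]
  refine Finset.sum_congr rfl fun s _ => ?_
  simp [hp]

lemma mistakes_eq_card {β β' : Fin L × Fin M → ℝ} {p p' : Fin L → Fin M}
    (hp : ∀ s q, β (s, q) = if q = p s then 1 else 0)
    (hp' : ∀ s q, β' (s, q) = if q = p' s then 1 else 0) :
    mistakes β' β = (Finset.univ.filter fun s => p' s ≠ p s).card := by
  unfold mistakes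
  rw [← Set.ncard_coe_finset]
  congr 1
  ext s
  simp only [Set.mem_ofPred_eq, Finset.coe_filter, Finset.mem_univ, true_and, hp, hp']
  constructor
  · rintro ⟨q, hq⟩ h
    exact hq (by rw [h])
  · intro h
    exact ⟨p' s, by simp [h]⟩

/-- The choices of positions that differ from `p` exactly in the sections of `S`. -/
def wrongChoices (p : Fin L → Fin M) (S : Finset (Fin L)) : Finset (Fin L → Fin M) :=
  Fintype.piFinset fun s => if s ∈ S then {p s}ᶜ else {p s}

lemma mem_wrongChoices {p p' : Fin L → Fin M} {S : Finset (Fin L)} :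
    p' ∈ wrongChoices p S ↔ ∀ s, p' s ≠ p s ↔ s ∈ S := by
  unfold wrongChoices
  rw [Fintype.mem_piFinset]
  refine forall_congr' fun s => ?_
  by_cases h : s ∈ S <;> simp [h]

lemma card_wrongChoices_le (p : Fin L → Fin M) (S : Finset (Fin L)) :
    (wrongChoices p S).card ≤ M ^ S.card := by
  unfold wrongChoices
  rw [Fintype.card_piFinset]
  calc ∏ s, (if s ∈ S then ({p s}ᶜ : Finset (Fin M)) else {p s}).card
      ≤ ∏ s, if s ∈ S then M else 1 := by
        refine Finset.prod_le_prod' fun s _ => ?_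
        split_ifs
        · exact (Finset.card_le_univ _).trans_eq (Fintype.card_fin M)
        · simp
    _ = M ^ S.card := by
        rw [Finset.prod_ite_mem, Finset.univ_inter, Finset.prod_const]

/-- The codeword of a choice wrong exactly in `S`: the sent one, with the columns of `S`
exchanged. -/
lemma sum_eq_of_mem_wrongChoices {p p' : Fin L → Fin M} {S : Finset (Fin L)}
    (h : p' ∈ wrongChoices p S) (x : Fin L × Fin M → ℝ) :
    ∑ s, x (s, p' s) = ∑ j ∈ columns p Sᶜ, x j + ∑ j ∈ columns p' S, x j := by
  rw [sum_columns, sum_columns, ← Finset.sum_compl_add_sum S]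
  congr 1
  refine Finset.sum_congr rfl fun s hs => ?_
  rw [mem_wrongChoices] at h
  have := (h s).not.mpr (Finset.mem_compl.mp hs)
  rw [not_not.mp this]

end Columns

/-! ### The loss terms -/

lemma le_one_add_iota₃ (L l : ℕ) (v α₀ : ℝ) (h₀ : α₀ * L ≤ l) (hl : l ≤ L) :
    Real.exp (phi l) * (1 + eta * (1 + v) / l) ≤ 1 + iota₃ L v α₀ := by
  unfold iota₃
  rw [add_sub_cancel]
  refine le_csSup (Set.Finite.bddAbove (Set.Finite.image _ ?_)) ⟨l, ⟨h₀, by exact_mod_cast hl⟩, rfl⟩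
  exact (Set.finite_Iic L).subset fun k hk => by simpa using hk.2

lemma one_le_exp_phi_mul {x y : ℝ} (hx : 0 < x) (hy : 0 ≤ y) :
    1 ≤ Real.exp (phi x) * (1 + y) := by
  have h1 := Real.one_le_exp (phi_nonneg hx)
  nlinarith

lemma le_one_add_iota₅ (L l : ℕ) (hL : 2 ≤ L) (hl : 0 < l) (h₀ : (L : ℝ) - √L ≤ l) (hlL : l < L) :
    Real.exp (phi l) * (1 + eta / l) ≤ 1 + iota₅ L := by
  have hlL1 : (l : ℝ) + 1 ≤ L := by exact_mod_cast hlL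
  have hl0 : (0 : ℝ) < l := by exact_mod_cast hl
  have hη := eta_pos
  have h1 : Real.exp (phi l) / √(1 - 1 / √L) * (1 + eta / l) ≤ 1 + iota₅ L := by
    unfold iota₅
    rw [add_sub_cancel]
    refine le_csSup (Set.Finite.bddAbove (Set.Finite.image _ ?_)) ⟨l, ⟨h₀, by linarith⟩, rfl⟩
    refine (Set.finite_Iic L).subset fun k hk => ?_
    have : (k : ℝ) ≤ L := by linarith [hk.2]
    exact_mod_cast this
  refine le_trans ?_ h1
  have hL1 : 1 < √(L : ℝ) := by
    rw [Real.lt_sqrt one_pos.le]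
    have : (2 : ℝ) ≤ L := by exact_mod_cast hL
    linarith
  have h2 : 0 < 1 - 1 / √(L : ℝ) := by
    rw [sub_pos, div_lt_one (by linarith)]; exact hL1
  have h3 : √(1 - 1 / √(L : ℝ)) ≤ 1 := by
    refine Real.sqrt_le_iff.mpr ⟨zero_le_one, ?_⟩
    have : 0 < 1 / √(L : ℝ) := by positivity
    linarith
  refine mul_le_mul_of_nonneg_right ?_ (by positivity)
  rw [le_div_iff₀ (Real.sqrt_pos.mpr h2)]
  exact mul_le_of_le_one_right (Real.exp_pos _).le h3

/-- The loss caused by the missed columns. When all sections are wrong there is none: the two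
residuals compared then coincide. -/
noncomputable def missedLoss (L l : ℕ) : ℝ :=
  if l < L then Real.exp (phi l) * (1 + eta / l) else 1

lemma one_le_missedLoss (L l : ℕ) (hl : 0 < l) : 1 ≤ missedLoss L l := by
  unfold missedLoss
  have hη := eta_pos
  split_ifs
  · exact one_le_exp_phi_mul (by exact_mod_cast hl) (by positivity)
  · exact le_rfl

lemma missedLoss_le (L l : ℕ) (α₀ : ℝ) (hL : 2 ≤ L) (hl : 0 < l) (h₀ : α₀ * L ≤ l) :
    missedLoss L l ≤ 1 + max (iota₄ L α₀) (iota₅ L) := by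
  have hη := eta_pos
  unfold missedLoss
  split_ifs with hlL
  · by_cases hc : (l : ℝ) ≤ L - √L
    · refine le_trans ?_ (add_le_add_right (le_max_left _ _) 1)
      have h1 : Real.exp (phi l + phi ((L : ℝ) - l)) * (1 + eta / l) * (1 + eta / ((L : ℝ) - l)) ≤
          1 + iota₄ L α₀ := by
        unfold iota₄
        rw [add_sub_cancel]
        refine le_csSup (Set.Finite.bddAbove (Set.Finite.image _ ?_)) ⟨l, ⟨h₀, hc⟩, rfl⟩
        refine (Set.finite_Iic L).subset fun k hk => ?_
        have : (k : ℝ) ≤ L := by linarith [hk.2, Real.sqrt_nonneg (L : ℝ)]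
        exact_mod_cast this
      refine le_trans ?_ h1
      have hd : (0 : ℝ) < L - l := sub_pos.mpr (by exact_mod_cast hlL)
      rw [Real.exp_add]
      have h2 := one_le_exp_phi_mul hd (y := eta / ((L : ℝ) - l)) (by positivity)
      calc Real.exp (phi l) * (1 + eta / l)
          ≤ Real.exp (phi l) * (1 + eta / l) *
              (Real.exp (phi ((L : ℝ) - l)) * (1 + eta / ((L : ℝ) - l))) :=
            le_mul_of_one_le_right (by positivity) h2
        _ = _ := by ring
    · refine le_trans ?_ (add_le_add_right (le_max_right _ _) 1)
      exact le_one_add_iota₅ L l hL hl (not_le.mp hc).le hlL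
  · refine le_trans ?_ (add_le_add_right (le_max_right _ _) 1)
    have hL1 : 0 < L - 1 := by omega
    have hcast : ((L - 1 : ℕ) : ℝ) = L - 1 := by
      rw [Nat.cast_sub (by omega), Nat.cast_one]
    refine le_trans ?_ (le_one_add_iota₅ L (L - 1) hL hL1 ?_ (by omega))
    · exact one_le_exp_phi_mul (by exact_mod_cast hL1) (by positivity)
    · rw [hcast]
      have : 1 ≤ √(L : ℝ) := by
        rw [Real.one_le_sqrt]; exact_mod_cast (by omega : 1 ≤ L)
      linarith

lemma lintegral_shrunk_vs_missed_le_missedLoss {ι : Type*} [Fintype ι] [DecidableEq ι]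
    (L l : ℕ) (hl : 0 < l) (hlL : l ≤ L)
    (P w r α q s₁ s₂ : ℝ) (hP : 0 < P) (hw : 0 < w) (hα : α = l / L)
    (hs₁ : s₁ = w + α ^ 2 * P) (hs₂ : s₂ = w + α * P) (hq : q = α * (1 - α) * P / s₂)
    (hr0 : 0 ≤ r) (hr1 : r ≤ 1) (A B : Finset ι) (hA : A.card = L - l) (hB : B.card = l)
    (hAB : Disjoint A B) :
    ∫⁻ e, ∫⁻ x, ENNReal.ofReal (Real.exp (
        r / 2 * ((e + α * (∑ j ∈ A, x j + ∑ j ∈ B, x j)) ^ 2 / s₁) -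
        r / 2 * ((e + ∑ j ∈ B, x j) ^ 2 / s₂))) ∂rowLaw ι L P ∂gaussianReal 0 w.toNNReal ≤
      ENNReal.ofReal (missedLoss L l * (√(1 - r ^ 2 * q))⁻¹) := by
  unfold missedLoss
  split_ifs with h
  · exact lintegral_shrunk_vs_missed_le L l hl h P w r α q s₁ s₂ hP hw hα hs₁ hs₂ hq hr0 hr1 A B
      hA hB hAB
  · have hlL' : l = L := by omega
    have hα1 : α = 1 := by
      rw [hα, hlL', div_self]
      exact_mod_cast (by omega : L ≠ 0)
    have hA0 : A = ∅ := by rw [← Finset.card_eq_zero, hA]; omega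
    have hs : s₁ = s₂ := by rw [hs₁, hs₂, hα1]; ring
    simp [hA0, hα1, hs, hq]

/-! ### Large deviation bounds -/

/-- Chernoff bound for the event that the normalised squared residual of the codeword sent exceeds
that of its shrunk version by at least `2 n t`. -/
lemma jointLaw_noise_ge_le (n L M : ℕ) (hL : 0 < L) (P σ α r q s₁ t : ℝ) (hP : 0 < P)
    (hσ : 0 < σ) (hs₁ : s₁ = σ ^ 2 + α ^ 2 * P) (hq : q = α ^ 2 * P / s₁) (hr : 0 ≤ r)
    (hrq : 0 < 1 - r ^ 2 * q) (J : Finset (Fin L × Fin M)) (hJ : J.card = L) :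
    jointLaw n L M P σ {ω | 0 ≤ ∑ i, ((ω.2 i ^ 2 / σ ^ 2 -
        (ω.2 i + α * ∑ j ∈ J, ω.1 i j) ^ 2 / s₁) / 2 - t)} ≤
      ENNReal.ofReal (Real.exp (-n * (r * t + 1 / 2 * Real.log (1 - r ^ 2 * q) - iota₂ L))) := by
  have hη := eta_pos
  have hL0 : (0 : ℝ) < L := by exact_mod_cast hL
  set Q : (Fin L × Fin M → ℝ) → ℝ → ℝ := fun x e =>
    -(r * t) + r / 2 * (e ^ 2 / σ ^ 2 - (e + α * ∑ j ∈ J, x j) ^ 2 / s₁) with hQ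
  have hQm : Measurable fun p : (Fin L × Fin M → ℝ) × ℝ => Q p.1 p.2 := by
    simp only [hQ]; fun_prop
  have hm : Measurable fun ω : (Fin n → Fin L × Fin M → ℝ) × (Fin n → ℝ) =>
      ENNReal.ofReal (Real.exp (∑ i, Q (ω.1 i) (ω.2 i))) := by
    simp only [hQ]; fun_prop
  refine (measure_le_lintegral_of_one_le _ hm ?_).trans ?_
  · intro ω hω
    rw [← ENNReal.ofReal_one]
    refine ENNReal.ofReal_le_ofReal (Real.one_le_exp ?_)
    have h1 : ∑ i, Q (ω.1 i) (ω.2 i) = r * ∑ i, ((ω.2 i ^ 2 / σ ^ 2 -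
        (ω.2 i + α * ∑ j ∈ J, ω.1 i j) ^ 2 / s₁) / 2 - t) := by
      rw [Finset.mul_sum]
      refine Finset.sum_congr rfl fun i _ => ?_
      simp only [hQ]
      ring
    rw [h1]
    exact mul_nonneg hr hω
  · rw [lintegral_jointLaw_exp_sum n L M P σ Q hQm]
    have h1 := lintegral_noise_vs_shrunk_le L hL P (σ ^ 2) α r q s₁ hP (by positivity) hs₁ hq hr
      hrq J hJ
    have h2 : ∫⁻ e, ∫⁻ x, ENNReal.ofReal (Real.exp (Q x e)) ∂rowLaw (Fin L × Fin M) L P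
        ∂gaussianReal 0 (σ ^ 2).toNNReal ≤
        ENNReal.ofReal (Real.exp (-(r * t)) *
          (Real.exp (phi L) * (1 + 2 * eta / L) * (√(1 - r ^ 2 * q))⁻¹)) := by
      simp only [hQ, Real.exp_add, ENNReal.ofReal_mul (Real.exp_pos (-(r * t))).le]
      simp_rw [lintegral_const_mul' (ENNReal.ofReal (Real.exp (-(r * t)))) _ ENNReal.ofReal_ne_top]
      exact mul_le_mul_right h1 _
    refine (pow_le_pow_left' h2 n).trans_eq ?_
    rw [← ENNReal.ofReal_pow (by positivity)]
    congr 1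
    have h3 : (√(1 - r ^ 2 * q))⁻¹ = Real.exp (-(1 / 2 * Real.log (1 - r ^ 2 * q))) := by
      rw [Real.exp_neg, Real.sqrt_eq_rpow, Real.rpow_def_of_pos hrq, mul_comm (1 / 2 : ℝ)]
    have h4 : Real.exp (phi L) * (1 + 2 * eta / L) = Real.exp (iota₂ L) := by
      unfold iota₂
      rw [Real.exp_add, Real.exp_log (by positivity)]
    rw [h3, h4, ← Real.exp_add, ← Real.exp_add, ← Real.exp_nat_mul]
    congr 1
    ring

/-- Young's inequality in exponential form; it replaces Jensen's inequality for the conditional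
expectation of a power. -/
lemma exp_mul_le {r : ℝ} (hr0 : 0 ≤ r) (hr1 : r ≤ 1) (a b : ℝ) :
    Real.exp (r * a) ≤ r * Real.exp (a + (r - 1) * b) + (1 - r) * Real.exp (r * b) := by
  have h := convexOn_exp.2 (Set.mem_univ (a + (r - 1) * b)) (Set.mem_univ (r * b)) hr0
    (sub_nonneg.mpr hr1) (by ring)
  simp only [smul_eq_mul] at h
  rwa [show r * (a + (r - 1) * b) + (1 - r) * (r * b) = r * a by ring] at h

/-- Union and Chernoff bound for the event that the normalised squared residual of some codeword
with exactly `l` wrong sections exceeds that of the shrunk codeword by at most `2 n t`. For every set `S` of wrong sections, the power `r ≤ 1` of the sum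
over the codewords wrong in `S` is linearised by `exp_mul_le` around its conditional expectation,
given the columns sent and the noise. -/
lemma jointLaw_exists_wrong_le (n L M l : ℕ) (hn : 0 < n) (hL : 0 < L) (hl : 0 < l) (hlL : l ≤ L)
    (hM : 0 < M) (P σ α r q s₁ t : ℝ) (hP : 0 < P) (hσ : 0 < σ) (hα : α = l / L)
    (hs₁ : s₁ = σ ^ 2 + α ^ 2 * P) (hq : q = α * (1 - α) * P / (σ ^ 2 + α * P))
    (hr0 : 0 ≤ r) (hr1 : r ≤ 1) (hrq : 0 < 1 - r ^ 2 * q) (p : Fin L → Fin M) :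
    jointLaw n L M P σ {ω | ∃ S : Finset (Fin L), S.card = l ∧ ∃ p' ∈ wrongChoices p S,
        0 ≤ ∑ i, (((ω.2 i + α * (∑ j ∈ columns p Sᶜ, ω.1 i j + ∑ j ∈ columns p S, ω.1 i j)) ^ 2 /
            s₁ - (ω.2 i + ∑ j ∈ columns p S, ω.1 i j - ∑ j ∈ columns p' S, ω.1 i j) ^ 2 / σ ^ 2) /
            2 + t)} ≤
      ENNReal.ofReal (L.choose l * Real.exp (-n * (r * (capa (P / σ ^ 2) α - α * rate n L M - t) +
        1 / 2 * Real.log (1 - r ^ 2 * q) -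
          Real.log (Real.exp (phi l) * (1 + eta * (1 + P / σ ^ 2) / l) * missedLoss L l)))) := by
  have hη := eta_pos
  have hl0 : (0 : ℝ) < l := by exact_mod_cast hl
  have hL0 : (0 : ℝ) < L := by exact_mod_cast hL
  have hn0 : (0 : ℝ) < n := by exact_mod_cast hn
  have hα0 : 0 < α := by rw [hα]; positivity
  set s₂ : ℝ := σ ^ 2 + α * P with hs₂
  set FC : ℝ := Real.exp (phi l) * (1 + eta * (1 + P / σ ^ 2) / l) with hFC
  set FB : ℝ := missedLoss L l with hFB
  have hFC1 : 1 ≤ FC := one_le_exp_phi_mul hl0 (by positivity)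
  have hFB1 : 1 ≤ FB := one_le_missedLoss L l hl
  set C : ℝ := capa (P / σ ^ 2) α with hC
  -- `n k₀`, less half the normalised squared residual of the missed columns, is the logarithm of a
  -- bound for the conditional expectation of the sum over the codewords wrong in a given `S`.
  set k₀ : ℝ := α * rate n L M + (Real.log FC - C) with hk₀
  set D : ℝ := (√(1 - r ^ 2 * q))⁻¹ with hD
  have hD0 : 0 < D := by positivity
  -- The two exponents to which Young's inequality leads.
  set Q₁ : Finset (Fin L) → (Fin L → Fin M) → (Fin L × Fin M → ℝ) → ℝ → ℝ := fun S p' x e =>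
    (r * t + (r - 1) * k₀) + (r / 2 * ((e + α * (∑ j ∈ columns p Sᶜ, x j +
      ∑ j ∈ columns p S, x j)) ^ 2 / s₁) + (1 - r) / 2 * ((e + ∑ j ∈ columns p S, x j) ^ 2 / s₂) -
      (e + ∑ j ∈ columns p S, x j - ∑ j ∈ columns p' S, x j) ^ 2 / σ ^ 2 / 2) with hQ₁
  set Q₂ : Finset (Fin L) → (Fin L × Fin M → ℝ) → ℝ → ℝ := fun S x e =>
    (r * t + r * k₀) + (r / 2 * ((e + α * (∑ j ∈ columns p Sᶜ, x j +
      ∑ j ∈ columns p S, x j)) ^ 2 / s₁) - r / 2 * ((e + ∑ j ∈ columns p S, x j) ^ 2 / s₂)) with hQ₂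
  have hQ₁m : ∀ S p', Measurable fun z : (Fin L × Fin M → ℝ) × ℝ => Q₁ S p' z.1 z.2 := by
    intro S p'; simp only [hQ₁]; fun_prop
  have hQ₂m : ∀ S, Measurable fun z : (Fin L × Fin M → ℝ) × ℝ => Q₂ S z.1 z.2 := by
    intro S; simp only [hQ₂]; fun_prop
  have hm₁ : ∀ S p', Measurable fun ω : (Fin n → Fin L × Fin M → ℝ) × (Fin n → ℝ) =>
      ENNReal.ofReal (Real.exp (∑ i, Q₁ S p' (ω.1 i) (ω.2 i))) := by
    intro S p'; simp only [hQ₁]; fun_prop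
  have hm₂ : ∀ S, Measurable fun ω : (Fin n → Fin L × Fin M → ℝ) × (Fin n → ℝ) =>
      ENNReal.ofReal (Real.exp (∑ i, Q₂ S (ω.1 i) (ω.2 i))) := by
    intro S; simp only [hQ₂]; fun_prop
  set G : ℝ := Real.exp (r * t + r * k₀) * (FB * D) with hG
  have hG0 : 0 ≤ G := by positivity
  have hexpC : (√(1 + l / L * (P / σ ^ 2)))⁻¹ = Real.exp (-C) := by
    rw [hC, capa, hα, Real.exp_neg, Real.sqrt_eq_rpow, Real.rpow_def_of_pos (by positivity),
      mul_comm (1 / 2 : ℝ)]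
  have hbase : ∀ S : Finset (Fin L), S.card = l → ∫⁻ e, ∫⁻ x, ENNReal.ofReal (Real.exp (
        r / 2 * ((e + α * (∑ j ∈ columns p Sᶜ, x j + ∑ j ∈ columns p S, x j)) ^ 2 / s₁) -
        r / 2 * ((e + ∑ j ∈ columns p S, x j) ^ 2 / s₂))) ∂rowLaw (Fin L × Fin M) L P
        ∂gaussianReal 0 (σ ^ 2).toNNReal ≤ ENNReal.ofReal (FB * D) := by
    intro S hS
    refine lintegral_shrunk_vs_missed_le_missedLoss L l hl hlL P (σ ^ 2) r α q s₁ s₂ hP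
      (by positivity) hα hs₁ rfl hq hr0 hr1 _ _ ?_ ?_ ?_
    · rw [card_columns, Finset.card_compl, Fintype.card_fin, hS]
    · rw [card_columns, hS]
    · exact disjoint_columns _ _ _ _ fun s hs hs' => absurd hs' (Finset.mem_compl.mp hs)
  have hint₂ : ∀ S : Finset (Fin L), S.card = l →
      ∫⁻ ω, ENNReal.ofReal (Real.exp (∑ i, Q₂ S (ω.1 i) (ω.2 i))) ∂jointLaw n L M P σ ≤
        ENNReal.ofReal (G ^ n) := by
    intro S hS
    rw [lintegral_jointLaw_exp_sum n L M P σ (Q₂ S) (hQ₂m S), ENNReal.ofReal_pow hG0]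
    refine pow_le_pow_left' ?_ n
    simp only [hQ₂, Real.exp_add (r * t + r * k₀), ENNReal.ofReal_mul (Real.exp_pos _).le, hG]
    simp_rw [lintegral_const_mul' (ENNReal.ofReal (Real.exp (r * t + r * k₀))) _
      ENNReal.ofReal_ne_top]
    exact mul_le_mul_right (hbase S hS) _
  have hMpow : (M : ℝ) ^ l * Real.exp (-(α * rate n L M)) ^ n = 1 := by
    have h1 : (M : ℝ) ^ l = Real.exp (l * Real.log M) := by
      rw [Real.exp_nat_mul, Real.exp_log (by exact_mod_cast hM)]
    rw [h1, ← Real.exp_nat_mul, ← Real.exp_add, Real.exp_eq_one_iff, hα, rate]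
    field_simp
    ring
  have hint₁ : ∀ S : Finset (Fin L), S.card = l → ∀ p' ∈ wrongChoices p S,
      ∫⁻ ω, ENNReal.ofReal (Real.exp (∑ i, Q₁ S p' (ω.1 i) (ω.2 i))) ∂jointLaw n L M P σ ≤
        ENNReal.ofReal ((Real.exp (-(α * rate n L M)) * G) ^ n) := by
    intro S hS p' hp'
    rw [lintegral_jointLaw_exp_sum n L M P σ (Q₁ S p') (hQ₁m S p'),
      ENNReal.ofReal_pow (by positivity)]
    refine pow_le_pow_left' ?_ n
    have hdis : ∀ s ∈ S, p s ≠ p' s := fun s hs => ((mem_wrongChoices.mp hp' s).mpr hs).symm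
    have hstep : ∀ e : ℝ, ∫⁻ x, ENNReal.ofReal (Real.exp (Q₁ S p' x e))
        ∂rowLaw (Fin L × Fin M) L P ≤
        ENNReal.ofReal (Real.exp (r * t + (r - 1) * k₀) * (FC * Real.exp (-C))) *
        ∫⁻ x, ENNReal.ofReal (Real.exp (r / 2 * ((e + α * (∑ j ∈ columns p Sᶜ, x j +
          ∑ j ∈ columns p S, x j)) ^ 2 / s₁) - r / 2 * ((e + ∑ j ∈ columns p S, x j) ^ 2 / s₂)))
          ∂rowLaw (Fin L × Fin M) L P := by
      intro e
      simp only [hQ₁, Real.exp_add (r * t + (r - 1) * k₀), ENNReal.ofReal_mul (Real.exp_pos _).le]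
      rw [lintegral_const_mul' _ _ ENNReal.ofReal_ne_top, mul_assoc]
      refine mul_le_mul_right ?_ _
      have h1 := lintegral_wrong_columns_le L l hL hl hlL P (σ ^ 2) r s₂ hP (by positivity)
        (by rw [hs₂, hα]) (columns p S) (columns p' S) (by rw [card_columns, hS])
        (disjoint_columns _ _ _ _ fun s hs _ => hdis s hs)
        (fun x => r / 2 * ((e + α * (∑ j ∈ columns p Sᶜ, x j +
          ∑ j ∈ columns p S, x j)) ^ 2 / s₁)) (by fun_prop) ?_ e
      · rw [hexpC] at h1
        exact h1
      · intro x y hxy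
        have hA : Disjoint (columns p Sᶜ) (columns p' S) :=
          disjoint_columns _ _ _ _ fun s hs hs' => absurd hs' (Finset.mem_compl.mp hs)
        have hB : Disjoint (columns p S) (columns p' S) :=
          disjoint_columns _ _ _ _ fun s hs _ => hdis s hs
        have e1 : ∑ j ∈ columns p Sᶜ, x j = ∑ j ∈ columns p Sᶜ, y j :=
          Finset.sum_congr rfl fun j hj => hxy j (Finset.disjoint_left.mp hA hj)
        have e2 : ∑ j ∈ columns p S, x j = ∑ j ∈ columns p S, y j :=
          Finset.sum_congr rfl fun j hj => hxy j (Finset.disjoint_left.mp hB hj)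
        simp only [e1, e2]
    refine (lintegral_mono hstep).trans ?_
    rw [lintegral_const_mul' _ _ ENNReal.ofReal_ne_top]
    refine (mul_le_mul_right (hbase S hS) _).trans_eq ?_
    rw [← ENNReal.ofReal_mul (by positivity)]
    congr 1
    have h2 : FC = Real.exp (Real.log FC) := (Real.exp_log (by linarith)).symm
    rw [hG, ← mul_assoc (Real.exp (-(α * rate n L M))), ← Real.exp_add]
    nth_rewrite 1 [h2]
    rw [← Real.exp_add, ← Real.exp_add]
    congr 2
    rw [hk₀]
    ring
  set F : (Fin n → Fin L × Fin M → ℝ) × (Fin n → ℝ) → ENNReal := fun ω =>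
    ∑ S ∈ Finset.univ.powersetCard l,
      (ENNReal.ofReal (1 - r) * ENNReal.ofReal (Real.exp (∑ i, Q₂ S (ω.1 i) (ω.2 i))) +
        ∑ p' ∈ wrongChoices p S,
          ENNReal.ofReal r * ENNReal.ofReal (Real.exp (∑ i, Q₁ S p' (ω.1 i) (ω.2 i)))) with hF
  have hFm : Measurable F := by
    refine Finset.measurable_sum _ fun S _ => ((hm₂ S).const_mul _).add ?_
    exact Finset.measurable_sum _ fun p' _ => (hm₁ S p').const_mul _
  refine (measure_le_lintegral_of_one_le _ hFm ?_).trans ?_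
  · rintro ω ⟨S, hS, p', hp', hω⟩
    have hSmem : S ∈ Finset.univ.powersetCard l :=
      Finset.mem_powersetCard.mpr ⟨Finset.subset_univ _, hS⟩
    refine le_trans ?_ (Finset.single_le_sum (f := fun S =>
      ENNReal.ofReal (1 - r) * ENNReal.ofReal (Real.exp (∑ i, Q₂ S (ω.1 i) (ω.2 i))) +
        ∑ p' ∈ wrongChoices p S,
          ENNReal.ofReal r * ENNReal.ofReal (Real.exp (∑ i, Q₁ S p' (ω.1 i) (ω.2 i))))
      (fun _ _ => zero_le) hSmem)
    refine le_trans ?_ (add_le_add_right (Finset.single_le_sum (f := fun p' =>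
      ENNReal.ofReal r * ENNReal.ofReal (Real.exp (∑ i, Q₁ S p' (ω.1 i) (ω.2 i))))
      (fun _ _ => zero_le) hp') _)
    rw [← ENNReal.ofReal_mul (by linarith), ← ENNReal.ofReal_mul hr0,
      ← ENNReal.ofReal_add (mul_nonneg (by linarith) (Real.exp_pos _).le)
        (mul_nonneg hr0 (Real.exp_pos _).le), ← ENNReal.ofReal_one]
    refine ENNReal.ofReal_le_ofReal ?_
    set U : ℝ := ∑ i, (ω.2 i + α * (∑ j ∈ columns p Sᶜ, ω.1 i j +
      ∑ j ∈ columns p S, ω.1 i j)) ^ 2 / s₁ with hU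
    set W : ℝ := ∑ i, (ω.2 i + ∑ j ∈ columns p S, ω.1 i j) ^ 2 / s₂ with hW
    set V : ℝ := ∑ i, (ω.2 i + ∑ j ∈ columns p S, ω.1 i j - ∑ j ∈ columns p' S, ω.1 i j) ^ 2 /
      σ ^ 2 with hV
    have e1 : ∑ i, Q₁ S p' (ω.1 i) (ω.2 i) =
        n * (r * t + (r - 1) * k₀) + (r / 2 * U + (1 - r) / 2 * W - V / 2) := by
      simp only [hQ₁, hU, hV, hW, Finset.sum_add_distrib, Finset.sum_sub_distrib, Finset.mul_sum,
        Finset.sum_div, Finset.sum_const, Finset.card_univ, Fintype.card_fin, nsmul_eq_mul]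
      ring
    have e2 : ∑ i, Q₂ S (ω.1 i) (ω.2 i) =
        n * (r * t + r * k₀) + (r / 2 * U - r / 2 * W) := by
      simp only [hQ₂, hU, hW, Finset.sum_add_distrib, Finset.sum_sub_distrib, Finset.mul_sum,
        Finset.sum_const, Finset.card_univ, Fintype.card_fin, nsmul_eq_mul]
      ring
    have e3 : 0 ≤ (U - V) / 2 + n * t := by
      refine hω.trans_eq ?_
      simp only [hU, hV, Finset.sum_add_distrib, ← Finset.sum_sub_distrib, Finset.sum_div,
        Finset.sum_const, Finset.card_univ, Fintype.card_fin, nsmul_eq_mul]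
    have h1 := exp_mul_le hr0 hr1 (-(V / 2)) (n * k₀ - W / 2)
    have h2 : 1 ≤ Real.exp (r * (U / 2 + n * t)) * Real.exp (r * -(V / 2)) := by
      rw [← Real.exp_add]
      refine Real.one_le_exp ?_
      have := mul_nonneg hr0 e3
      linarith
    refine h2.trans ((mul_le_mul_of_nonneg_left h1 (Real.exp_pos _).le).trans_eq ?_)
    rw [mul_add, mul_left_comm, mul_left_comm _ (1 - r), ← Real.exp_add, ← Real.exp_add, e1, e2,
      add_comm]
    congr 3 <;> ring
  · have hcard : (Finset.univ.powersetCard l : Finset (Finset (Fin L))).card = L.choose l := by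
      rw [Finset.card_powersetCard, Finset.card_univ, Fintype.card_fin]
    have hterm : ∀ S ∈ (Finset.univ.powersetCard l : Finset (Finset (Fin L))),
        ∫⁻ ω, (ENNReal.ofReal (1 - r) * ENNReal.ofReal (Real.exp (∑ i, Q₂ S (ω.1 i) (ω.2 i))) +
        ∑ p' ∈ wrongChoices p S,
          ENNReal.ofReal r * ENNReal.ofReal (Real.exp (∑ i, Q₁ S p' (ω.1 i) (ω.2 i))))
          ∂jointLaw n L M P σ ≤ ENNReal.ofReal (G ^ n) := by
      intro S hS
      have hSl : S.card = l := (Finset.mem_powersetCard.mp hS).2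
      rw [lintegral_add_left ((hm₂ S).const_mul _), lintegral_const_mul _ (hm₂ S),
        lintegral_finsetSum _ fun p' _ => (hm₁ S p').const_mul _]
      have h1 : ∑ p' ∈ wrongChoices p S, ∫⁻ ω, ENNReal.ofReal r *
          ENNReal.ofReal (Real.exp (∑ i, Q₁ S p' (ω.1 i) (ω.2 i))) ∂jointLaw n L M P σ ≤
          ENNReal.ofReal r * ENNReal.ofReal (G ^ n) := by
        calc _ ≤ ∑ p' ∈ wrongChoices p S, ENNReal.ofReal r *
              ENNReal.ofReal ((Real.exp (-(α * rate n L M)) * G) ^ n) := by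
              refine Finset.sum_le_sum fun p' hp' => ?_
              rw [lintegral_const_mul _ (hm₁ S p')]
              exact mul_le_mul_right (hint₁ S hSl p' hp') _
          _ ≤ (M ^ l : ℕ) * (ENNReal.ofReal r *
              ENNReal.ofReal ((Real.exp (-(α * rate n L M)) * G) ^ n)) := by
              rw [Finset.sum_const, nsmul_eq_mul]
              refine mul_le_mul_left ?_ _
              exact_mod_cast (card_wrongChoices_le p S).trans_eq (by rw [hSl])
          _ = _ := by
              rw [← ENNReal.ofReal_natCast, mul_left_comm, ← ENNReal.ofReal_mul (by positivity),
                mul_pow, ← mul_assoc, Nat.cast_pow, hMpow, one_mul]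
      refine (add_le_add (mul_le_mul_right (hint₂ S hSl) _) h1).trans_eq ?_
      rw [← add_mul, ← ENNReal.ofReal_add (by linarith) hr0, sub_add_cancel, ENNReal.ofReal_one,
        one_mul]
    simp only [hF]
    refine (lintegral_finsetSum _ fun S _ => ?_).trans_le ((Finset.sum_le_sum hterm).trans ?_)
    · exact ((hm₂ S).const_mul _).add
        (Finset.measurable_sum _ fun p' _ => (hm₁ S p').const_mul _)
    rw [Finset.sum_const, hcard, nsmul_eq_mul, ← ENNReal.ofReal_natCast,
      ← ENNReal.ofReal_mul (by positivity)]
    refine ENNReal.ofReal_le_ofReal (mul_le_mul_of_nonneg_left ?_ (by positivity))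
    have hFBe : FB = Real.exp (Real.log FB) := (Real.exp_log (by linarith)).symm
    have hDe : D = Real.exp (-(1 / 2 * Real.log (1 - r ^ 2 * q))) := by
      rw [hD, Real.exp_neg, Real.sqrt_eq_rpow, Real.rpow_def_of_pos hrq, mul_comm (1 / 2 : ℝ)]
    have hGe : G =
        Real.exp (r * t + r * k₀ + (Real.log FB + -(1 / 2 * Real.log (1 - r ^ 2 * q)))) := by
      rw [Real.exp_add, Real.exp_add (Real.log FB), ← hFBe, ← hDe]
    rw [hGe, ← Real.exp_nat_mul]
    refine Real.exp_le_exp.mpr ?_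
    rw [Real.log_mul (by linarith) (by linarith), hk₀]
    have hlogFC : r * Real.log FC ≤ 1 * Real.log FC :=
      mul_le_mul_of_nonneg_right hr1 (Real.log_nonneg hFC1)
    have := mul_le_mul_of_nonneg_left hlogFC hn0.le
    nlinarith

/-! ### The exponents as functions of the threshold -/

/-- A supremum of affine functions with slopes in `[0, K]` is Lipschitz. -/
lemma continuous_sSup_affine (S : Set ℝ) (h : ℝ → ℝ) (K H : ℝ) (hS : S.Nonempty)
    (hK : ∀ r ∈ S, 0 ≤ r ∧ r ≤ K) (hH : ∀ r ∈ S, h r ≤ H) :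
    Continuous fun Δ : ℝ => sSup ((fun r => r * Δ + h r) '' S) := by
  obtain ⟨r₀, hr₀⟩ := hS
  have hK0 : 0 ≤ K := (hK r₀ hr₀).1.trans (hK r₀ hr₀).2
  have hbdd : ∀ Δ : ℝ, BddAbove ((fun r => r * Δ + h r) '' S) := by
    intro Δ
    refine ⟨K * |Δ| + H, ?_⟩
    rintro _ ⟨r, hr, rfl⟩
    have h1 : r * Δ ≤ K * |Δ| :=
      (mul_le_mul_of_nonneg_left (le_abs_self Δ) (hK r hr).1).trans
        (mul_le_mul_of_nonneg_right (hK r hr).2 (abs_nonneg Δ))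
    exact add_le_add h1 (hH r hr)
  have hlip : ∀ Δ Δ' : ℝ, sSup ((fun r => r * Δ + h r) '' S) ≤
      sSup ((fun r => r * Δ' + h r) '' S) + K * |Δ - Δ'| := by
    intro Δ Δ'
    refine csSup_le ⟨_, r₀, hr₀, rfl⟩ ?_
    rintro _ ⟨r, hr, rfl⟩
    have h1 : r * Δ' + h r ≤ sSup ((fun r => r * Δ' + h r) '' S) :=
      le_csSup (hbdd Δ') ⟨r, hr, rfl⟩
    have h2 : r * (Δ - Δ') ≤ K * |Δ - Δ'| :=
      (mul_le_mul_of_nonneg_left (le_abs_self _) (hK r hr).1).trans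
        (mul_le_mul_of_nonneg_right (hK r hr).2 (abs_nonneg _))
    linarith
  refine (LipschitzWith.of_le_add_mul ⟨K, hK0⟩ fun Δ Δ' => ?_).continuous
  rw [Real.dist_eq]
  exact hlip Δ Δ'

lemma half_log_one_sub_le {r q : ℝ} (hq : 0 ≤ q) (h : 0 < 1 - r ^ 2 * q) :
    1 / 2 * Real.log (1 - r ^ 2 * q) ≤ 0 := by
  have := Real.log_nonpos h.le (by nlinarith [mul_nonneg (sq_nonneg r) hq])
  linarith

lemma continuous_expD {q : ℝ} (hq : 0 < q) : Continuous fun Δ => expD Δ q := by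
  refine continuous_sSup_affine _ _ (√(1 / q)) 0 ⟨0, by simp⟩ ?_ ?_
  · rintro r ⟨h0, h1⟩
    refine ⟨h0, Real.le_sqrt_of_sq_le ?_⟩
    rw [le_div_iff₀ hq]
    linarith
  · rintro r ⟨_, h1⟩
    exact half_log_one_sub_le hq.le h1

lemma continuous_expD₁ {q : ℝ} (hq : 0 ≤ q) : Continuous fun Δ => expD₁ Δ q := by
  refine continuous_sSup_affine _ _ 1 0 ⟨0, by simp⟩ ?_ ?_
  · rintro r ⟨h0, h1, _⟩
    exact ⟨h0, h1⟩
  · rintro r ⟨_, _, h1⟩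
    exact half_log_one_sub_le hq h1

lemma oneSubRhoSq₁_nonneg {v α : ℝ} (hv : 0 ≤ v) (hα : 0 ≤ α) (hα1 : α ≤ 1) :
    0 ≤ oneSubRhoSq₁ v α := by
  unfold oneSubRhoSq₁
  have : 0 ≤ 1 - α := by linarith
  positivity

lemma continuous_errBer (n L M l : ℕ) (v α₀ : ℝ) (hv : 0 < v) (hl : 0 < l) (hL : 0 < L)
    (hlL : l ≤ L) : Continuous (errBer n L M v α₀ l) := by
  have hL0 : (0 : ℝ) < L := by exact_mod_cast hL
  have hα : (0 : ℝ) < l / L := div_pos (by exact_mod_cast hl) hL0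
  have hα1 : (l : ℝ) / L ≤ 1 := by rw [div_le_one hL0]; exact_mod_cast hlL
  have h1 := continuous_expD₁ (oneSubRhoSq₁_nonneg hv.le hα.le hα1)
  have h2 : Continuous fun Δ => expD Δ (oneSubRhoSq₂ v (l / L)) := by
    refine continuous_expD ?_
    unfold oneSubRhoSq₂
    positivity
  have h3 : Continuous fun t : ℝ => expD₁ (capa v (l / L) - l / L * rate n L M - t)
      (oneSubRhoSq₁ v (l / L)) := h1.comp (by fun_prop)
  unfold errBer
  fun_prop

/-- A bound by exponentials at all points of a set passes to its supremum. -/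
lemma le_mul_exp_sSup {S : Set ℝ} (hS : S.Nonempty) {m C n b : ℝ} (hC : 0 ≤ C) (hn : 0 < n)
    (h : ∀ x ∈ S, m ≤ C * Real.exp (-n * (x - b))) : m ≤ C * Real.exp (-n * (sSup S - b)) := by
  rcases le_or_gt m 0 with hm | hm
  · exact hm.trans (by positivity)
  obtain ⟨x₀, hx₀⟩ := hS
  have hC0 : 0 < C := by
    rcases hC.lt_or_eq with h0 | h0
    · exact h0
    · have := h x₀ hx₀
      rw [← h0, zero_mul] at this
      linarith
  have key : ∀ x : ℝ, m ≤ C * Real.exp (-n * (x - b)) ↔ x ≤ b - Real.log (m / C) / n := by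
    intro x
    rw [← div_le_iff₀' hC0, ← Real.log_le_iff_le_exp (div_pos hm hC0), le_sub_iff_add_le,
      ← le_sub_iff_add_le', div_le_iff₀ hn]
    constructor <;> intro h <;> linarith
  rw [key]
  exact csSup_le ⟨x₀, hx₀⟩ fun x hx => (key x).mp (h x hx)

/-! ### The probability of exactly `l` section mistakes -/

/-- The bound for a fixed threshold `t`. If `l` sections are wrong, some codeword wrong in `l`
sections is at least as close to the output as the one sent. In terms of normalised squared
residuals, either that of the sent codeword exceeds that of its shrunk version by `2 n t`, or that
of the wrong codeword exceeds it by at most `2 n t`. -/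
lemma jointLaw_mistakeEvent_le_errBer (n L M l : ℕ) (hn : 0 < n) (hL : 2 ≤ L) (hl : 0 < l)
    (hlL : l ≤ L) (P σ α₀ : ℝ) (hP : 0 < P) (hσ : 0 < σ) (h₀ : α₀ * L ≤ l)
    (dec : (Fin n → Fin L × Fin M → ℝ) → (Fin n → ℝ) → (Fin L × Fin M → ℝ))
    (hdec : IsLeastSquaresDecoder dec) (β : Fin L × Fin M → ℝ) (hβ : β ∈ codebook L M) (t : ℝ) :
    (jointLaw n L M P σ).real (mistakeEvent dec β l) ≤ errBer n L M (P / σ ^ 2) α₀ l t := by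
  have hη := eta_pos
  have hL' : 0 < L := by omega
  have hl0 : (0 : ℝ) < l := by exact_mod_cast hl
  have hL0 : (0 : ℝ) < L := by exact_mod_cast hL'
  have hn0 : (0 : ℝ) < n := by exact_mod_cast hn
  obtain ⟨p, hp⟩ := exists_choice_of_mem_codebook hβ
  have hM : 0 < M := (p ⟨0, hL'⟩).pos
  set α : ℝ := (l : ℝ) / L with hα
  have hα0 : 0 < α := by positivity
  have hα1 : α ≤ 1 := by rw [hα, div_le_one hL0]; exact_mod_cast hlL
  set v : ℝ := P / σ ^ 2 with hv
  have hv0 : 0 < v := by positivity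
  set s₁ : ℝ := σ ^ 2 + α ^ 2 * P with hs₁
  have hq₁ : oneSubRhoSq₁ v α = α * (1 - α) * P / (σ ^ 2 + α * P) := by
    unfold oneSubRhoSq₁
    rw [hv]
    field_simp
  have hq₂ : oneSubRhoSq₂ v α = α ^ 2 * P / s₁ := by
    unfold oneSubRhoSq₂
    rw [hv, hs₁]
    field_simp
  set E₁ : Set ((Fin n → Fin L × Fin M → ℝ) × (Fin n → ℝ)) :=
    {ω | ∃ S : Finset (Fin L), S.card = l ∧ ∃ p' ∈ wrongChoices p S,
        0 ≤ ∑ i, (((ω.2 i + α * (∑ j ∈ columns p Sᶜ, ω.1 i j + ∑ j ∈ columns p S, ω.1 i j)) ^ 2 /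
            s₁ - (ω.2 i + ∑ j ∈ columns p S, ω.1 i j - ∑ j ∈ columns p' S, ω.1 i j) ^ 2 / σ ^ 2) /
            2 + t)} with hE₁
  set E₂ : Set ((Fin n → Fin L × Fin M → ℝ) × (Fin n → ℝ)) :=
    {ω | 0 ≤ ∑ i, ((ω.2 i ^ 2 / σ ^ 2 -
        (ω.2 i + α * ∑ j ∈ columns p Finset.univ, ω.1 i j) ^ 2 / s₁) / 2 - t)} with hE₂
  have hsub : mistakeEvent dec β l ⊆ E₁ ∪ E₂ := by
    intro ω hω
    by_cases h2 : ω ∈ E₂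
    · exact Or.inr h2
    refine Or.inl ?_
    set Y := codeword ω.1 β + ω.2 with hY
    obtain ⟨hmem, hmin⟩ := hdec ω.1 Y
    obtain ⟨p', hp'⟩ := exists_choice_of_mem_codebook hmem
    have hcard : mistakes (dec ω.1 Y) β = l := hω
    rw [mistakes_eq_card hp hp'] at hcard
    refine ⟨Finset.univ.filter fun s => p' s ≠ p s, hcard, p',
      mem_wrongChoices.mpr fun s => by simp, ?_⟩
    set S : Finset (Fin L) := Finset.univ.filter fun s => p' s ≠ p s with hS
    have hp'S : p' ∈ wrongChoices p S := mem_wrongChoices.mpr fun s => by simp [hS]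
    have hpsum : ∀ i, ∑ j ∈ columns p Finset.univ, ω.1 i j =
        ∑ j ∈ columns p Sᶜ, ω.1 i j + ∑ j ∈ columns p S, ω.1 i j := by
      intro i
      rw [sum_columns, sum_columns, sum_columns, Finset.sum_compl_add_sum]
    have hle := hmin β hβ
    have e1 : sqNorm (Y - codeword ω.1 β) = ∑ i, ω.2 i ^ 2 := by
      simp [sqNorm, hY]
    have e2 : sqNorm (Y - codeword ω.1 (dec ω.1 Y)) = ∑ i,
        (ω.2 i + ∑ j ∈ columns p S, ω.1 i j - ∑ j ∈ columns p' S, ω.1 i j) ^ 2 := by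
      unfold sqNorm
      refine Finset.sum_congr rfl fun i _ => ?_
      have h3 : codeword ω.1 β i = ∑ j ∈ columns p Sᶜ, ω.1 i j + ∑ j ∈ columns p S, ω.1 i j := by
        rw [codeword_eq_sum ω.1 hp, ← hpsum, sum_columns]
      have h4 : codeword ω.1 (dec ω.1 Y) i =
          ∑ j ∈ columns p Sᶜ, ω.1 i j + ∑ j ∈ columns p' S, ω.1 i j := by
        rw [codeword_eq_sum ω.1 hp', sum_eq_of_mem_wrongChoices hp'S]
      rw [Pi.sub_apply, h4, hY, Pi.add_apply, h3]
      ring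
    rw [e1, e2] at hle
    have h2' : ∑ i, ((ω.2 i ^ 2 / σ ^ 2 -
        (ω.2 i + α * ∑ j ∈ columns p Finset.univ, ω.1 i j) ^ 2 / s₁) / 2 - t) < 0 := not_le.mp h2
    simp_rw [hpsum] at h2'
    have h5 : (∑ i, (ω.2 i + ∑ j ∈ columns p S, ω.1 i j - ∑ j ∈ columns p' S, ω.1 i j) ^ 2) /
        σ ^ 2 ≤ (∑ i, ω.2 i ^ 2) / σ ^ 2 := by gcongr
    simp only [Finset.sum_add_distrib, Finset.sum_sub_distrib, ← Finset.sum_div] at h2' ⊢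
    linarith
  set ι₁ : ℝ := iota₁ L v α₀ with hι₁
  have hloss : Real.log (Real.exp (phi l) * (1 + eta * (1 + v) / l) * missedLoss L l) ≤ ι₁ := by
    have h1 := le_one_add_iota₃ L l v α₀ h₀ hlL
    have h2 := missedLoss_le L l α₀ hL hl h₀
    have h3 := one_le_missedLoss L l hl
    have h4 : 1 ≤ Real.exp (phi l) * (1 + eta * (1 + v) / l) :=
      one_le_exp_phi_mul hl0 (by positivity)
    exact Real.log_le_log (by positivity) (mul_le_mul h1 h2 (by linarith) (by linarith))
  have hb₁ : (jointLaw n L M P σ).real E₁ ≤ L.choose l *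
      Real.exp (-n * (expD₁ (capa v α - α * rate n L M - t) (oneSubRhoSq₁ v α) - ι₁)) := by
    unfold expD₁
    refine le_mul_exp_sSup (Set.Nonempty.image _ ⟨0, by simp⟩) (by positivity) hn0 ?_
    rintro _ ⟨r, ⟨hr0, hr1, hr⟩, rfl⟩
    have h := jointLaw_exists_wrong_le n L M l hn hL' hl hlL hM P σ α r (oneSubRhoSq₁ v α) s₁ t hP
      hσ hα hs₁ hq₁ hr0 hr1 hr p
    refine (ENNReal.toReal_le_of_le_ofReal (by positivity) h).trans ?_
    gcongr ?_ * Real.exp ?_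
    have := mul_le_mul_of_nonneg_left hloss hn0.le
    nlinarith
  have hb₂ : (jointLaw n L M P σ).real E₂ ≤
      Real.exp (-n * (expD t (oneSubRhoSq₂ v α) - iota₂ L)) := by
    rw [← one_mul (Real.exp _)]
    unfold expD
    refine le_mul_exp_sSup (Set.Nonempty.image _ ⟨0, by simp⟩) zero_le_one hn0 ?_
    rintro _ ⟨r, ⟨hr0, hr⟩, rfl⟩
    have h := jointLaw_noise_ge_le n L M hL' P σ α r (oneSubRhoSq₂ v α) s₁ t hP hσ hs₁ hq₂ hr0 hr
      (columns p Finset.univ) (by rw [card_columns, Finset.card_univ, Fintype.card_fin])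
    rw [one_mul]
    exact ENNReal.toReal_le_of_le_ofReal (by positivity) h
  calc (jointLaw n L M P σ).real (mistakeEvent dec β l)
      ≤ (jointLaw n L M P σ).real (E₁ ∪ E₂) := measureReal_mono hsub
    _ ≤ (jointLaw n L M P σ).real E₁ + (jointLaw n L M P σ).real E₂ := measureReal_union_le _ _
    _ ≤ errBer n L M v α₀ l t := add_le_add hb₁ hb₂

end SparseSuperposition

open SparseSuperposition
theorem lemma5 (n L M : ℕ) (hn : 0 < n) (hL : 2 ≤ L)
    (P σ α₀ : ℝ) (hP : 0 < P) (hσ : 0 < σ) (hα₀ : 0 < α₀) (hα₀' : α₀ ≤ 1)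
    (l : ℕ) (hl : α₀ ≤ (l : ℝ) / L) (hl' : (l : ℝ) / L ≤ 1)
    (hR : 0 ≤ capa (P / σ ^ 2) ((l : ℝ) / L) - (l : ℝ) / L * rate n L M)
    (dec : (Fin n → Fin L × Fin M → ℝ) → (Fin n → ℝ) → (Fin L × Fin M → ℝ))
    (hdec : IsLeastSquaresDecoder dec)
    (β : Fin L × Fin M → ℝ) (hβ : β ∈ codebook L M) :
    ∃ m : ℝ,
      IsLeast (errBer n L M (P / σ ^ 2) α₀ l ''
        Set.Icc 0 (capa (P / σ ^ 2) ((l : ℝ) / L) - (l : ℝ) / L * rate n L M)) m ∧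
      (jointLaw n L M P σ).real (mistakeEvent dec β l) ≤ m := by
  have hL0 : (0 : ℝ) < L := by exact_mod_cast (by omega : 0 < L)
  have h₀ : α₀ * L ≤ l := (le_div_iff₀ hL0).mp hl
  have hl0 : 0 < l := by
    have : (0 : ℝ) < l := lt_of_lt_of_le (by positivity) h₀
    exact_mod_cast this
  have hlL : l ≤ L := by exact_mod_cast (div_le_one hL0).mp hl'
  have hcont := continuous_errBer n L M l (P / σ ^ 2) α₀ (by positivity) hl0 (by omega) hlL
  obtain ⟨m, hm⟩ := (isCompact_Icc.image hcont).exists_isLeast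
    ((Set.nonempty_Icc.mpr hR).image _)
  refine ⟨m, hm, ?_⟩
  obtain ⟨t, _, rfl⟩ := hm.1
  exact jointLaw_mistakeEvent_le_errBer n L M l hn hL hl0 hlL P σ α₀ hP hσ h₀ dec hdec β hβ t
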